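/- Let $p\ge 1$ be an integer and let ${\rm bit}(p)$ be its number of binary digits. For a real closed field $R$ and $P,Q\in R[y]$ with $\deg P=p$, let ${\rm Her}(P;Q)\in R^{p\times p}$ be the Hermite matrix, whose $(j_1,j_2)$ entry ($1\le j_1,j_2\le p$) is the trace of the multiplication by $Q(y)\,y^{j_1+j_2-2}$ on the $R$-vector space $R[y]/(P)$. For $0\le j\le p-1$ let ${\rm hmi}_j(P;Q)$ be the leading principal minor of order $p-j$ of ${\rm Her}(P;Q)$, let ${\rm hmi}_p(P;Q)=1$, and let ${\rm hmi}(P;Q)=[{\rm hmi}_0(P;Q),\dots,{\rm hmi}_p(P;Q)]$. For $\alpha\in\{0,1,2\}^{\{1,\dots,p-1\}}$ let $P_\alpha=\prod_{h=1}^{p-1}(P^{(h)})^{\alpha_h}$ and $|\alpha|_0=\#\{h\mid \alpha_h\ne 0\}$. Let ${\rm thelim}(P)$ be the list of all entries of the lists ${\rm hmi}(P;P_\alpha)$ with $|\alpha|_0\le{\rm bit}(p)$, and let ${\rm thelim}(P;Q)$ be the list of all entries of the lists ${\rm hmi}(P;P_\alpha B)$ with $|\alpha|_0\le{\rm bit}(p)-1$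 and $B\in\{Q,Q^2\}$. The entries of the first list are indexed by the pairs $(\alpha,j)$, those of the second by the triples consisting of $\alpha$, the exponent of $Q$ in $B$, and $j$. The Thom encoding with respect to $P$ of a root $\theta\in R$ of $P$ is the list ${\rm Thom}_P(\theta)=({\rm sign}\,P^{(k)}(\theta))_{1\le k\le p-1}\in\{-1,0,1\}^{p-1}$. Then the list of signs of ${\rm thelim}(P)$ and ${\rm thelim}(P;Q)$ determines the Thom encodings of the roots of $P$ in $R$ and the sign of $Q$ at each of these roots. Precisely: there are maps $T$ and $S$, depending only on $p$, which assign to every pair $(\tau,\tau')$ of lists of signs, indexed as above, a set $T(\tau,\tau')\subseteq\{-1,0,1\}^{p-1}$ and a function $S(\tau,\tau'):\{-1,0,1\}^{p-1}\to\{-1,0,1\}$, such that for every real closed field $R$ and all $P,Q\in R[y]$ with $\deg P=p$, writing $\tau={\rm sign}({\rm thelim}(P))$ and $\tau'={\rm sign}({\rm thelim}(P;Q))$: 1. $\theta\mapsto{\rm Thom}_P(\theta)$ is a bijection from the set of roots of $P$ in $R$ onto $T(\tau,\tau')$; 2. ${\rm sign}(Q(\theta))=S(\tau,\tau')({\rm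 Thom}_P(\theta))$ for every root $\theta\in R$ of $P$. -/

import Mathlib

open Polynomial

noncomputable section

namespace SignDetermination

/-- The number of binary digits needed to write `p`: it is `1` for `p = 0`, and it is the `k` with
`2 ^ (k - 1) ≤ p < 2 ^ k` for `p ≥ 1`. -/
def bit (p : ℕ) : ℕ := Nat.log 2 p + 1

/-- The Hermite matrix `Her(P; Q)`. With indices starting at `0`, its `(i, j)` entry is the trace of
the multiplication by `Q * X ^ (i + j)` on the `R`-vector space `R[X] / (P)`. -/
def her {R : Type*} [Field R] (P Q : R[X]) : Matrix (Fin P.natDegree) (Fin P.natDegree) R :=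
  Matrix.of fun i j =>
    Algebra.trace R (AdjoinRoot P) (AdjoinRoot.mk P (Q * X ^ ((i : ℕ) + (j : ℕ))))

/-- `hmi_j(P; Q)`: with `p = deg P`, the `(p - j)`-th leading principal minor of `Her(P; Q)`.
For `j = p` it is the determinant of the empty matrix, which is `1`. -/
def hmi {R : Type*} [Field R] (P Q : R[X]) (j : ℕ) : R :=
  ((her P Q).submatrix (Fin.castLE (Nat.sub_le P.natDegree j))
    (Fin.castLE (Nat.sub_le P.natDegree j))).det

/-- The exponent vectors `α ∈ {0, 1, 2} ^ {1, …, p - 1}` with at most `j` nonzero entries;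
position `h : Fin (p - 1)` stands for the index `h + 1`. -/
abbrev Exponents (p j : ℕ) : Type :=
  {α : Fin (p - 1) → Fin 3 // (Finset.univ.filter fun h => α h ≠ 0).card ≤ j}

/-- The element `∏_{1 ≤ h ≤ p - 1} (P^{(h)}) ^ (α_h)` of `PDer_j(P)` with exponent vector `α`. -/
def pder {R : Type*} [Field R] {p j : ℕ} (P : R[X]) (α : Exponents p j) : R[X] :=
  ∏ h : Fin (p - 1), (derivative^[(h : ℕ) + 1] P) ^ (α.1 h : ℕ)

/-- The positions of the list `thelim(P)` for `deg P = p`: a position is an exponent vector,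
which gives an element `A` of `PDer_{bit(p)}(P)`, and an index `0 ≤ j ≤ p` in `hmi(P; A)`. -/
abbrev ThelimIndex (p : ℕ) : Type := Exponents p (bit p) × Fin (p + 1)

/-- The list `thelim(P)` for `deg P = p`. -/
def thelim {R : Type*} [Field R] (p : ℕ) (P : R[X]) : ThelimIndex p → R :=
  fun i => hmi P (pder P i.1) i.2

/-- The positions of the list `thelim(P; Q)` for `deg P = p`: an exponent vector, which gives an
element `A` of `PDer_{bit(p) - 1}(P)`, a choice of `B` in `{Q, Q ^ 2}`, and an index `0 ≤ j ≤ p` in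
`hmi(P; A * B)`. -/
abbrev ThelimWithIndex (p : ℕ) : Type := Exponents p (bit p - 1) × Fin 2 × Fin (p + 1)

/-- The list `thelim(P; Q)` for `deg P = p`. -/
def thelimWith {R : Type*} [Field R] (p : ℕ) (P Q : R[X]) : ThelimWithIndex p → R :=
  fun i => hmi P (pder P i.1 * Q ^ ((i.2.1 : ℕ) + 1)) i.2.2

/-- The list of the signs of the entries of a list (given as a family indexed by its positions). -/
def signs {R : Type*} [Field R] [LinearOrder R] {ι : Type*} (l : ι → R) : ι → SignType :=
  fun i => SignType.sign (l i)

/-- The sign conditions on `Der(P')`, that is on `P', P'', …, P^{(p - 1)}`, for `deg P = p`;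
position `k : Fin (p - 1)` stands for the index `k + 1`. -/
abbrev ThomCode (p : ℕ) : Type := Fin (p - 1) → SignType

/-- The Thom encoding of `θ` with respect to `P`, for `deg P = p`: the list of the signs of
`P', P'', …, P^{(p - 1)}` at `θ`. -/
def thomEncoding {R : Type*} [Field R] [LinearOrder R] (p : ℕ) (P : R[X]) (θ : R) : ThomCode p :=
  fun k => SignType.sign ((derivative^[(k : ℕ) + 1] P).eval θ)

end SignDetermination

end

/-! Everything passes through the Tarski queries TaQ(A), the sum of sign A(θ) over the distinct
roots θ of P in R. By Hermite, TaQ(A) is the signature of the form (f, g) ↦ Tr(A f g): over the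
algebraically closed field R[i] the form is diagonal in the evaluations at the roots, non-real
conjugate pairs contribute nothing to the signature, and a root θ in R contributes sign A(θ). Its
matrix is Hankel, so by Frobenius' rule the signs of the leading principal minors give the signature
even when some of them vanish (`frobeniusState_hermite`).

For A = P_α the queries are moments Σ_σ c(σ) ∏ σ_h ^ α_h of the weight c that counts roots by Thom
encoding; for A = P_α Q they are moments of the weight that carries sign Q(θ). By Thom's lemma
(`eq_of_sign_derivative_eq`) an encoding belongs to at most one root, so the two weights contain the
answer.

Few moments suffice: a nonzero weight on fewer than 2^(k+1) sign conditions has a nonzero moment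
with at most k nonzero exponents (`exists_moment_ne_zero`). Two candidates for c have together at
most 2p < 2^(bit(p)+1) support points. Once the encodings are known, the second weight lives on at
most p < 2^bit(p) points, so one exponent fewer is enough, and the queries with B = Q already fix
it. T and S are read off from the solutions of these moment equations, which mention only p and the
signs. -/

noncomputable section

/-! ### Algebraic closedness of R[i] (Artin's Galois argument) -/

theorem IsRealClosed.finrank_eq_one_of_odd {R F : Type*} [Field R] [CharZero R] [IsRealClosed R]
    [Field F] [Algebra R F] [FiniteDimensional R F] (h : Odd (Module.finrank R F)) :
    Module.finrank R F = 1 := by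
  obtain ⟨α, hα⟩ := Field.exists_primitive_element R F
  have hint : IsIntegral R α := Algebra.IsIntegral.isIntegral α
  have hdeg : (minpoly R α).natDegree = Module.finrank R F := by
    rw [← IntermediateField.adjoin.finrank hint, hα, IntermediateField.finrank_top']
  obtain ⟨x, hx⟩ := IsRealClosed.exists_isRoot_of_odd_natDegree (f := minpoly R α) (hdeg ▸ h)
  rw [← hdeg]
  exact natDegree_eq_of_degree_eq_some
    (degree_eq_one_of_irreducible_of_root (minpoly.irreducible hint) hx)

/-- The fixed field of a Sylow 2-subgroup has odd degree over R, hence is R, so the whole Galois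
group is a 2-group. -/
theorem IsRealClosed.exists_finrank_eq_two_pow {R N : Type*} [Field R] [CharZero R]
    [IsRealClosed R] [Field N] [Algebra R N] [FiniteDimensional R N] [IsGalois R N] :
    ∃ a : ℕ, Module.finrank R N = 2 ^ a := by
  have : Fact (Nat.Prime 2) := ⟨Nat.prime_two⟩
  obtain ⟨H⟩ : Nonempty (Sylow 2 Gal(N/R)) := inferInstance
  have h1 : Module.finrank R (IntermediateField.fixedField (H : Subgroup Gal(N/R))) =
      (H : Subgroup Gal(N/R)).index := by
    rw [IntermediateField.finrank_eq_fixingSubgroup_index,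
      IntermediateField.fixingSubgroup_fixedField]
  have h2 : Odd (H : Subgroup Gal(N/R)).index := by
    rw [← Nat.not_even_iff_odd, even_iff_two_dvd]
    exact H.not_dvd_index
  have h3 := IsRealClosed.finrank_eq_one_of_odd (h1 ▸ h2)
  rw [h1, Subgroup.index_eq_one] at h3
  obtain ⟨a, ha⟩ := IsPGroup.iff_card.mp H.isPGroup'
  refine ⟨a, ?_⟩
  rw [← IsGalois.card_aut_eq_finrank, ← ha]
  have : Nat.card (⊤ : Subgroup Gal(N/R)) = Nat.card Gal(N/R) := Subgroup.card_top
  rw [← this, ← h3]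

theorem finrank_ne_two_of_forall_isSquare {K M : Type*} [Field K] [CharZero K]
    (hK : ∀ x : K, IsSquare x) [Field M] [Algebra K M] [FiniteDimensional K M] :
    Module.finrank K M ≠ 2 := by
  intro h
  obtain ⟨α, hα⟩ := Field.exists_primitive_element K M
  have hint : IsIntegral K α := Algebra.IsIntegral.isIntegral α
  have hdeg : (minpoly K α).natDegree = 2 := by
    rw [← h, ← IntermediateField.adjoin.finrank hint, hα, IntermediateField.finrank_top']
  have hirr := minpoly.irreducible hint
  set f := minpoly K α
  have hf := f.as_sum_range_C_mul_X_pow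
  have hmon : f.coeff 2 = 1 := hdeg ▸ minpoly.monic hint
  rw [hdeg] at hf
  simp only [Finset.sum_range_succ, Finset.sum_range_zero, hmon] at hf
  obtain ⟨r, hr⟩ := hK (f.coeff 1 ^ 2 / 4 - f.coeff 0)
  have hroot : f.IsRoot (r - f.coeff 1 / 2) := by
    rw [IsRoot, hf]
    simp
    linear_combination -hr
  have := degree_eq_one_of_irreducible_of_root hirr hroot
  rw [degree_eq_natDegree hirr.ne_zero, hdeg] at this
  norm_num at this

/-- A nontrivial 2-group has a subgroup of index 2; its fixed field would be a quadratic extension,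
excluded by the quadratic formula. -/
theorem finrank_eq_one_of_forall_isSquare {K N : Type*} [Field K] [CharZero K]
    (hK : ∀ x : K, IsSquare x) [Field N] [Algebra K N] [FiniteDimensional K N] [IsGalois K N]
    {b : ℕ} (hb : Module.finrank K N = 2 ^ b) : Module.finrank K N = 1 := by
  have : Fact (Nat.Prime 2) := ⟨Nat.prime_two⟩
  rcases b with _ | b
  · simpa using hb
  exfalso
  have hcard : Nat.card Gal(N/K) = 2 ^ (b + 1) := by rw [IsGalois.card_aut_eq_finrank, hb]
  obtain ⟨H, hH⟩ := Sylow.exists_subgroup_card_pow_prime (G := Gal(N/K)) 2 (n := b)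
    (hcard ▸ pow_dvd_pow 2 b.le_succ)
  apply finrank_ne_two_of_forall_isSquare hK (M := IntermediateField.fixedField H)
  rw [IntermediateField.finrank_eq_fixingSubgroup_index, IntermediateField.fixingSubgroup_fixedField]
  have := H.card_mul_index
  rw [hH, hcard, pow_succ] at this
  exact Nat.eq_of_mul_eq_mul_left (by positivity) this

theorem IsRealClosed.isAlgClosed_of_forall_isSquare {R K : Type*} [Field R] [CharZero R]
    [IsRealClosed R] [Field K] [Algebra R K] [FiniteDimensional R K]
    (hK : ∀ x : K, IsSquare x) : IsAlgClosed K := by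
  have : CharZero K := charZero_of_injective_algebraMap (algebraMap R K).injective
  apply IsAlgClosed.of_exists_root
  intro f hf hirr
  have : Fact (Irreducible f) := ⟨hirr⟩
  let E := AdjoinRoot f
  have : FiniteDimensional K E := (AdjoinRoot.powerBasis hirr.ne_zero).finite
  have : FiniteDimensional R E := FiniteDimensional.trans R K E
  let Ω := AlgebraicClosure E
  have : Algebra.IsAlgebraic R Ω := Algebra.IsAlgebraic.trans R E Ω
  have : IsAlgClosure R Ω := ⟨inferInstance, inferInstance⟩
  have : Normal R Ω := IsAlgClosure.normal R Ω
  let N := IntermediateField.normalClosure R E Ω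
  have : IsGalois R N := ⟨⟩
  obtain ⟨a, ha⟩ := IsRealClosed.exists_finrank_eq_two_pow (R := R) (N := N)
  let : Algebra K N := ((algebraMap E N).comp (algebraMap K E)).toAlgebra
  have : IsScalarTower K E N := IsScalarTower.of_algebraMap_eq fun _ => rfl
  have : IsScalarTower R K N := IsScalarTower.of_algebraMap_eq fun x => by
    rw [IsScalarTower.algebraMap_apply K E N, ← IsScalarTower.algebraMap_apply R K E,
      ← IsScalarTower.algebraMap_apply R E N]
  have : FiniteDimensional K N := FiniteDimensional.right R K N
  have : IsGalois K N := IsGalois.tower_top_of_isGalois R K N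
  obtain ⟨b, -, hb⟩ := (Nat.dvd_prime_pow Nat.prime_two).mp
    (ha ▸ Dvd.intro_left _ (Module.finrank_mul_finrank R K N))
  have h1 := finrank_eq_one_of_forall_isSquare hK hb
  have h2 : Module.finrank K E = 1 := by
    have := Module.finrank_mul_finrank K E N
    rw [h1] at this
    exact Nat.eq_one_of_mul_eq_one_right this
  rw [(AdjoinRoot.powerBasis hirr.ne_zero).finrank, AdjoinRoot.powerBasis_dim] at h2
  exact exists_root_of_degree_eq_one (degree_eq_iff_natDegree_eq hirr.ne_zero |>.mpr h2)

section Complexification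

variable {R : Type*} [Field R] [LinearOrder R] [IsStrictOrderedRing R]

/-- This fact, that -1 is not a square, is what makes `QuadraticAlgebra R (-1) 0` a field. -/
instance : Fact (∀ r : R, r ^ 2 ≠ -1 + 0 * r) :=
  ⟨fun r h => by nlinarith [sq_nonneg r]⟩

variable [IsRealClosed R]

theorem IsRealClosed.isSquare_quadraticAlgebra (z : QuadraticAlgebra R (-1) 0) : IsSquare z := by
  obtain ⟨x, y⟩ := z
  obtain ⟨m, hm⟩ := IsRealClosed.exists_eq_pow_of_nonneg
    (add_nonneg (sq_nonneg x) (sq_nonneg y)) two_ne_zero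
  wlog hm0 : 0 ≤ m generalizing m
  · exact this (-m) (by rw [hm]; ring) (by linarith)
  have hx : |x| ≤ m := abs_le_of_sq_le_sq (by nlinarith [sq_nonneg y]) hm0
  rw [abs_le] at hx
  obtain ⟨u, hu⟩ := IsRealClosed.exists_eq_pow_of_nonneg
    (show 0 ≤ (m + x) / 2 by linarith) two_ne_zero
  obtain ⟨v, hv⟩ := IsRealClosed.exists_eq_pow_of_nonneg
    (show 0 ≤ (m - x) / 2 by linarith) two_ne_zero
  -- Half-angle formulas: with m = |z|, u² - v² = x and 2uv = ±y, so u + iv or u - iv is a square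
  -- root.
  have h4 : (2 * u * v) ^ 2 = y ^ 2 := by
    have : (2 * u * v) ^ 2 = 4 * u ^ 2 * v ^ 2 := by ring
    rw [this, ← hu, ← hv]
    linear_combination -hm
  rcases sq_eq_sq_iff_eq_or_eq_neg.mp h4 with h | h
  · refine ⟨⟨u, v⟩, ?_⟩
    ext <;> simp
    · linear_combination hu - hv
    · linear_combination -h
  · refine ⟨⟨u, -v⟩, ?_⟩
    ext <;> simp
    · linear_combination hu - hv
    · linear_combination h

instance IsRealClosed.isAlgClosed_quadraticAlgebra : IsAlgClosed (QuadraticAlgebra R (-1) 0) :=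
  IsRealClosed.isAlgClosed_of_forall_isSquare (R := R) IsRealClosed.isSquare_quadraticAlgebra

end Complexification

/-! ### Inertia of symmetric forms over an ordered field -/

namespace LinearMap.BilinForm

variable {R V : Type*} [Field R] [LinearOrder R] [AddCommGroup V] [Module R V]

/-- `B.HasInertia W s n`: the subspace `W` contains a positive definite and a negative definite
subspace for `B` whose dimensions have sum `n` and difference `s`. -/
def HasInertia (B : LinearMap.BilinForm R V) (W : Submodule R V) (s : ℤ) (n : ℕ) : Prop :=
  ∃ P N : Submodule R V, P ≤ W ∧ N ≤ W ∧ FiniteDimensional R P ∧ FiniteDimensional R N ∧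
    (∀ x ∈ P, x ≠ 0 → 0 < B x x) ∧ (∀ x ∈ N, x ≠ 0 → B x x < 0) ∧
    Module.finrank R P + Module.finrank R N = n ∧
    (Module.finrank R P : ℤ) - Module.finrank R N = s

variable {B : LinearMap.BilinForm R V} {W W' : Submodule R V} {s s' : ℤ} {n n' : ℕ}

theorem HasInertia.mono (h : B.HasInertia W s n) (hW : W ≤ W') : B.HasInertia W' s n := by
  obtain ⟨P, N, hP, hN, h⟩ := h
  exact ⟨P, N, hP.trans hW, hN.trans hW, h⟩

theorem hasInertia_zero (B : LinearMap.BilinForm R V) (W : Submodule R V) :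
    B.HasInertia W 0 0 :=
  ⟨⊥, ⊥, bot_le, bot_le, inferInstance, inferInstance, by simp, by simp, by simp, by simp⟩

theorem pos_sup_of_orthogonal [IsStrictOrderedRing R] {P P' : Submodule R V}
    [FiniteDimensional R P] [FiniteDimensional R P']
    (hP : ∀ x ∈ P, x ≠ 0 → 0 < B x x) (hP' : ∀ x ∈ P', x ≠ 0 → 0 < B x x)
    (h : ∀ x ∈ P, ∀ y ∈ P', B x y = 0) (h' : ∀ x ∈ P, ∀ y ∈ P', B y x = 0) :
    (∀ x ∈ P ⊔ P', x ≠ 0 → 0 < B x x) ∧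
    Module.finrank R ↥(P ⊔ P') = Module.finrank R P + Module.finrank R P' := by
  constructor
  · intro z hz hz0
    obtain ⟨x, hx, y, hy, rfl⟩ := Submodule.mem_sup.mp hz
    have : B (x + y) (x + y) = B x x + B y y := by simp [h x hx y hy, h' x hx y hy]
    rw [this]
    by_cases hx0 : x = 0
    · subst hx0
      simpa using hP' y hy (by simpa using hz0)
    · by_cases hy0 : y = 0
      · subst hy0
        simpa using hP x hx hx0
      · exact add_pos (hP x hx hx0) (hP' y hy hy0)
  · have hd : P ⊓ P' = ⊥ := by
      rw [Submodule.eq_bot_iff]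
      rintro x ⟨hx, hx'⟩
      by_contra hx0
      exact (hP x hx hx0).ne' (h x hx x hx')
    have := Submodule.finrank_sup_add_finrank_inf_eq P P'
    rw [hd, finrank_bot] at this
    simpa using this

theorem HasInertia.sup [IsStrictOrderedRing R] (hW : B.HasInertia W s n)
    (hW' : B.HasInertia W' s' n')
    (h : ∀ x ∈ W, ∀ y ∈ W', B x y = 0) (h' : ∀ x ∈ W, ∀ y ∈ W', B y x = 0) :
    B.HasInertia (W ⊔ W') (s + s') (n + n') := by
  obtain ⟨P, N, hP, hN, _, _, hPp, hNn, hn, hs⟩ := hW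
  obtain ⟨P', N', hP', hN', _, _, hPp', hNn', hn', hs'⟩ := hW'
  obtain ⟨h1, h2⟩ := pos_sup_of_orthogonal hPp hPp' (fun x hx y hy => h x (hP hx) y (hP' hy))
    (fun x hx y hy => h' x (hP hx) y (hP' hy))
  obtain ⟨h3, h4⟩ := pos_sup_of_orthogonal (B := -B) (P := N) (P' := N')
    (by simpa using hNn) (by simpa using hNn')
    (fun x hx y hy => by simp [h x (hN hx) y (hN' hy)])
    (fun x hx y hy => by simp [h' x (hN hx) y (hN' hy)])
  refine ⟨P ⊔ P', N ⊔ N', sup_le_sup hP hP', sup_le_sup hN hN', inferInstance, inferInstance,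
    h1, by simpa using h3, by omega, by omega⟩

theorem hasInertia_span_singleton [IsStrictOrderedRing R] (B : LinearMap.BilinForm R V) {v : V}
    (hv : B v v ≠ 0) : B.HasInertia (R ∙ v) (SignType.sign (B v v) : ℤ) 1 := by
  have hv0 : v ≠ 0 := by rintro rfl; simp at hv
  have key : ∀ x ∈ R ∙ v, x ≠ 0 → ∃ c : R, 0 < c * c ∧ B x x = c * c * B v v := by
    intro x hx hx0
    obtain ⟨c, rfl⟩ := Submodule.mem_span_singleton.mp hx
    have : c ≠ 0 := by rintro rfl; simp at hx0
    exact ⟨c, mul_self_pos.mpr this, by simp [mul_assoc]⟩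
  rcases hv.lt_or_gt with h | h
  · refine ⟨⊥, R ∙ v, bot_le, le_rfl, inferInstance, inferInstance, by simp, ?_, ?_, ?_⟩
    · intro x hx hx0
      obtain ⟨c, hc, hx⟩ := key x hx hx0
      rw [hx]; exact mul_neg_of_pos_of_neg hc h
    · simp [finrank_span_singleton hv0]
    · simp [finrank_span_singleton hv0, sign_neg h]
  · refine ⟨R ∙ v, ⊥, le_rfl, bot_le, inferInstance, inferInstance, ?_, by simp, ?_, ?_⟩
    · intro x hx hx0
      obtain ⟨c, hc, hx⟩ := key x hx hx0
      rw [hx]; exact mul_pos hc h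
    · simp [finrank_span_singleton hv0]
    · simp [finrank_span_singleton hv0, sign_pos h]

theorem HasInertia.add_span_singleton [IsStrictOrderedRing R] (hW : B.HasInertia W s n) {v : V}
    (hv : B v v ≠ 0) (h : ∀ x ∈ W, B x v = 0) (h' : ∀ x ∈ W, B v x = 0) :
    B.HasInertia (W ⊔ R ∙ v) (s + (SignType.sign (B v v) : ℤ)) (n + 1) := by
  refine hW.sup (hasInertia_span_singleton B hv) ?_ ?_ <;> intro x hx y hy <;>
    obtain ⟨c, rfl⟩ := Submodule.mem_span_singleton.mp hy
  · simp [h x hx]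
  · simp [h' x hx]

/-- The forms `l i` with `0 < c i` have no common zero on P other than 0, since there B x x would be
a sum of nonpositive terms. -/
theorem finrank_le_card_of_pos [IsStrictOrderedRing R] {ι : Type*} [Fintype ι] {c : ι → R}
    {l : ι → V →ₗ[R] R} (hB : ∀ v, B v v = ∑ i, c i * l i v ^ 2) {P : Submodule R V}
    (hP : ∀ x ∈ P, x ≠ 0 → 0 < B x x) :
    Module.finrank R P ≤ Fintype.card {i // 0 < c i} := by
  let φ : P →ₗ[R] ({i // 0 < c i} → R) := LinearMap.pi fun i => (l i).comp P.subtype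
  rw [← Module.finrank_fintype_fun_eq_card R]
  apply LinearMap.finrank_le_finrank_of_injective (f := φ)
  rw [← LinearMap.ker_eq_bot, LinearMap.ker_eq_bot']
  intro x hx
  by_contra hx0
  have h := hP x x.2 (by simpa using hx0)
  apply h.not_ge
  rw [hB]
  apply Finset.sum_nonpos
  intro i _
  by_cases hi : 0 < c i
  · have : l i x = 0 := congrFun hx (⟨i, hi⟩ : {i // 0 < c i})
    simp [this]
  · exact mul_nonpos_of_nonpos_of_nonneg (not_lt.mp hi) (sq_nonneg _)

theorem card_pos_add_card_neg_le {ι : Type*} [Fintype ι] (c : ι → R) :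
    Fintype.card {i // 0 < c i} + Fintype.card {i // c i < 0} ≤ Fintype.card ι := by
  classical
  rw [Fintype.card_subtype, Fintype.card_subtype, ← Finset.card_union_of_disjoint]
  · exact Finset.card_le_univ _
  · rw [Finset.disjoint_filter]
    intro i _ h h'
    exact h.not_gt h'

/-- Sylvester's law of inertia for a form written as a combination of squares. -/
theorem HasInertia.eq_sum_sign [IsStrictOrderedRing R] {ι : Type*} [Fintype ι] {c : ι → R}
    {l : ι → V →ₗ[R] R} (hB : ∀ v, B v v = ∑ i, c i * l i v ^ 2) (h : B.HasInertia W s n)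
    (hn : Fintype.card ι ≤ n) : s = ∑ i, (SignType.sign (c i) : ℤ) := by
  obtain ⟨P, N, -, -, -, -, hP, hN, rfl, rfl⟩ := h
  have h1 := finrank_le_card_of_pos hB hP
  have h2 := finrank_le_card_of_pos (B := -B) (c := -c) (l := l) (by simp [hB]) (P := N)
    (by simpa using hN)
  simp only [Pi.neg_apply, Left.neg_pos_iff] at h2
  have h3 : ∑ i, (SignType.sign (c i) : ℤ) =
      (Fintype.card {i // 0 < c i} : ℤ) - Fintype.card {i // c i < 0} := by
    rw [Fintype.card_subtype, Fintype.card_subtype, Finset.card_filter, Finset.card_filter]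
    push_cast
    rw [← Finset.sum_sub_distrib]
    refine Finset.sum_congr rfl fun i _ => ?_
    rcases lt_trichotomy (c i) 0 with h | h | h
    · simp [h, h.not_gt]
    · simp [h]
    · simp [h, h.not_gt]
  have h4 := card_pos_add_card_neg_le c
  rw [h3]
  omega

theorem hasInertia_hyperbolic [IsStrictOrderedRing R] (hB : ∀ x y, B x y = B y x) {e f : V}
    (he : B e e = 0) (hef : B e f ≠ 0) : B.HasInertia (Submodule.span R {e, f}) 0 2 := by
  set t := B e f with ht
  -- This makes g isotropic without changing its pairing with e; then g + e and g - e are orthogonal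
  -- with opposite values ±2t.
  set g := f - (B f f / (2 * t)) • e with hg
  have heg : B e g = t := by simp [hg, he, ht]
  have hgg : B g g = 0 := by
    simp only [hg, map_sub, map_smul, LinearMap.sub_apply, LinearMap.smul_apply, smul_eq_mul, he,
      hB f e, ← ht]
    field_simp
    ring
  have hge : B g e = t := by rw [hB, heg]
  have h1 : B (g + e) (g + e) = 2 * t := by simp [hgg, he, hge, heg]; ring
  have h2 : B (g - e) (g - e) = -(2 * t) := by simp [hgg, he, hge, heg]; ring
  have h3 : B (g + e) (g - e) = 0 := by simp [hgg, he, hge, heg]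
  have h2t : 2 * t ≠ 0 := mul_ne_zero two_ne_zero hef
  have h := (hasInertia_span_singleton B (h1 ▸ h2t)).add_span_singleton (v := g - e)
    (h2 ▸ neg_ne_zero.mpr h2t) ?_ ?_
  · rw [h1, h2, Left.sign_neg] at h
    simp only [SignType.coe_neg, add_neg_cancel] at h
    have hem : e ∈ Submodule.span R {e, f} := Submodule.subset_span (by simp)
    have hfm : f ∈ Submodule.span R {e, f} := Submodule.subset_span (by simp)
    have hgm : g ∈ Submodule.span R {e, f} := sub_mem hfm (Submodule.smul_mem _ _ hem)
    refine h.mono (sup_le ?_ ?_) <;> rw [Submodule.span_singleton_le_iff_mem]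
    · exact add_mem hgm hem
    · exact sub_mem hgm hem
  · intro x hx
    obtain ⟨c, rfl⟩ := Submodule.mem_span_singleton.mp hx
    rw [map_smul, LinearMap.smul_apply, h3, smul_zero]
  · intro x hx
    obtain ⟨c, rfl⟩ := Submodule.mem_span_singleton.mp hx
    rw [map_smul, hB, h3, smul_zero]

/-- The inertia of a form whose Gram matrix is antitriangular with constant antidiagonal. -/
theorem hasInertia_antitriangular [IsStrictOrderedRing R] (hB : ∀ x y, B x y = B y x) {t : R}
    (ht : t ≠ 0) : ∀ (k : ℕ) (w : ℕ → V), (∀ a b, a + b + 1 < k → B (w a) (w b) = 0) →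
      (∀ a b, a + b + 1 = k → B (w a) (w b) = t) →
      B.HasInertia (Submodule.span R (w '' Set.Iio k))
        (if Odd k then (SignType.sign t : ℤ) else 0) k
  | 0, _, _, _ => by simpa using hasInertia_zero B _
  | 1, w, _, h1 => by
    have h := h1 0 0 rfl
    have := hasInertia_span_singleton B (h ▸ ht)
    rw [h] at this
    simpa using this
  | k + 2, w, h0, h1 => by
    -- The outer vectors w 0 and w (k + 1) span a hyperbolic plane. The inner ones are already
    -- orthogonal to w 0; subtracting a multiple of w 0 makes them orthogonal to w (k + 1) and
    -- leaves the Gram entries needed for the recursion unchanged.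
    have hrec := hasInertia_antitriangular hB ht k
      (fun a => w (a + 1) - (B (w (a + 1)) (w (k + 1)) / t) • w 0) ?_ ?_
    · have hhyp := hasInertia_hyperbolic hB (h0 0 0 (by omega)) (h1 0 (k + 1) (by omega) ▸ ht)
      have hort : ∀ x ∈ Submodule.span R {w 0, w (k + 1)}, ∀ y ∈ Submodule.span R
          ((fun a => w (a + 1) - (B (w (a + 1)) (w (k + 1)) / t) • w 0) '' Set.Iio k),
          B x y = 0 := by
        intro x hx y hy
        induction hx using Submodule.span_induction with
        | zero => simp
        | add x x' _ _ hx hx' => simp [hx, hx']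
        | smul c x _ hx => simp [hx]
        | mem x hx =>
          induction hy using Submodule.span_induction with
          | zero => simp
          | add y y' _ _ hy hy' => simp [hy, hy']
          | smul c y _ hy => simp [hy]
          | mem y hy =>
            obtain ⟨a, ha, rfl⟩ := hy
            simp only [Set.mem_Iio] at ha
            rcases hx with rfl | rfl
            · simp [h0 0 (a + 1) (by omega), h0 0 0 (by omega)]
            · simp [hB (w (k + 1)), h1 0 (k + 1) (by omega), ht]
      have h := hhyp.sup hrec hort (fun x hx y hy => by rw [hB, hort x hx y hy])
      have hodd : Odd (k + 2) ↔ Odd k := by simp [Nat.odd_add]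
      rw [zero_add, add_comm 2 k] at h
      simp only [hodd]
      have hw : ∀ a < k + 2, w a ∈ Submodule.span R (w '' Set.Iio (k + 2)) := fun a ha =>
        Submodule.subset_span ⟨a, ha, rfl⟩
      refine h.mono (sup_le ?_ ?_) <;> rw [Submodule.span_le]
      · rintro x (rfl | rfl)
        exacts [hw _ (by omega), hw _ (by omega)]
      · rintro x ⟨a, ha, rfl⟩
        simp only [Set.mem_Iio] at ha
        exact sub_mem (hw _ (by omega)) (Submodule.smul_mem _ _ (hw _ (by omega)))
    · intro a b hab
      simp [h0 (a + 1) (b + 1) (by omega), h0 0 (b + 1) (by omega), h0 (a + 1) 0 (by omega),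
        h0 0 0 (by omega)]
    · intro a b hab
      simp [h1 (a + 1) (b + 1) (by omega), h0 0 (b + 1) (by omega), h0 (a + 1) 0 (by omega),
        h0 0 0 (by omega)]

end LinearMap.BilinForm

/-! ### Hankel forms and Frobenius' rule -/

theorem Matrix.det_antitriangular {R : Type*} [CommRing R] {k : ℕ} {t : R}
    (A : Matrix (Fin k) (Fin k) R) (h0 : ∀ a b : Fin k, (a : ℕ) + b + 1 < k → A a b = 0)
    (h1 : ∀ a b : Fin k, (a : ℕ) + b + 1 = k → A a b = t) :
    A.det = ((Equiv.Perm.sign (Fin.revPerm : Equiv.Perm (Fin k)) : ℤ) : R) * t ^ k := by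
  have h := Matrix.det_permute' (Fin.revPerm : Equiv.Perm (Fin k)) A
  rw [Matrix.det_of_isLowerTriangular (M := A.submatrix id Fin.revPerm)] at h
  · have h2 : ∀ i, A.submatrix id Fin.revPerm i i = t := fun i => by
      apply h1
      simp [Fin.val_rev]
      omega
    simp only [h2, Finset.prod_const, Finset.card_univ, Fintype.card_fin] at h
    rw [h, ← mul_assoc, ← Int.cast_mul, ← Units.val_mul, Int.units_mul_self]
    simp
  · intro a b hab
    apply h0
    have : (a : ℕ) < b := hab
    simp [Fin.val_rev]
    omega

namespace Polynomial

variable {R : Type*} [Field R]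

/-- The symmetric bilinear form `(f, g) ↦ L (f * g)` on polynomials. -/
def hankelForm (L : R[X] →ₗ[R] R) : LinearMap.BilinForm R R[X] :=
  (LinearMap.mul R R[X]).compr₂ L

@[simp] theorem hankelForm_apply (L : R[X] →ₗ[R] R) (f g : R[X]) :
    hankelForm L f g = L (f * g) := rfl

theorem hankelForm_comm (L : R[X] →ₗ[R] R) (f g : R[X]) :
    hankelForm L f g = hankelForm L g f := by simp [mul_comm]

/-- The Hankel matrix of order `n` of the moments `L (X ^ k)`. -/
def hankelMatrix (L : R[X] →ₗ[R] R) (n : ℕ) : Matrix (Fin n) (Fin n) R :=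
  Matrix.of fun i j => L (X ^ ((i : ℕ) + (j : ℕ)))

variable {L : R[X] →ₗ[R] R}

/-- The passage from the monomials to the w a is unitriangular. -/
theorem det_gram_of_monic {w : ℕ → R[X]} (hw : ∀ a, (w a).Monic) (hd : ∀ a, (w a).natDegree = a)
    (n : ℕ) : (Matrix.of fun i j : Fin n => L (w i * w j)).det = (hankelMatrix L n).det := by
  set M : Matrix (Fin n) (Fin n) R := Matrix.of fun i j => (w j).coeff i with hM
  have hMdet : M.det = 1 := Matrix.det_matrixOfPolynomials (fun j : Fin n => w j)
    (fun j => hd j) (fun j => hw j)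
  have hexp : ∀ j : Fin n, w j = ∑ a : Fin n, (w j).coeff a • X ^ (a : ℕ) := fun j => by
    conv_lhs => rw [(w j).as_sum_range' n (by rw [hd]; exact j.2)]
    rw [Finset.sum_range]
    simp [← C_mul_X_pow_eq_monomial, smul_eq_C_mul]
  have : (Matrix.of fun i j : Fin n => L (w i * w j)) = M.transpose * hankelMatrix L n * M := by
    ext i j
    rw [Matrix.of_apply, hexp i, hexp j, Finset.sum_mul_sum, Finset.sum_comm]
    simp only [Matrix.mul_apply, Finset.sum_mul, map_sum]
    refine (Finset.sum_congr rfl fun a _ => Finset.sum_congr rfl fun b _ => ?_)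
    simp [hM, hankelMatrix, pow_add]
    ring
  rw [this, Matrix.det_mul, Matrix.det_mul, Matrix.det_transpose, hMdet]
  simp

theorem map_mul_eq_zero_of_degree_lt {q : R[X]} {N : ℕ} (h : ∀ m < N, L (q * X ^ m) = 0)
    {f : R[X]} (hf : f ∈ degreeLT R N) : L (q * f) = 0 := by
  classical
  rw [degreeLT_eq_span_X_pow] at hf
  induction hf using Submodule.span_induction with
  | zero => simp
  | add f g _ _ hf hg => simp [mul_add, hf, hg]
  | smul c f _ hf => simp [hf]
  | mem f hf =>
    simp only [Finset.coe_image, Set.mem_image, Finset.coe_range, Set.mem_Iio] at hf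
    obtain ⟨m, hm, rfl⟩ := hf
    exact h m hm

/-- The orthogonal polynomial of degree `i` for the functional `L`. -/
theorem exists_orthogonal_monic {i : ℕ} (h : (hankelMatrix L i).det ≠ 0) :
    ∃ q : R[X], q.Monic ∧ q.natDegree = i ∧ ∀ m < i, L (q * X ^ m) = 0 := by
  set c := (hankelMatrix L i)⁻¹.mulVec (fun a : Fin i => L (X ^ (i + (a : ℕ)))) with hc
  have hHc : (hankelMatrix L i).mulVec c = fun a : Fin i => L (X ^ (i + (a : ℕ))) := by
    rw [hc, Matrix.mulVec_mulVec, Matrix.mul_nonsing_inv _ (isUnit_iff_ne_zero.mpr h),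
      Matrix.one_mulVec]
  set r := ∑ b : Fin i, c b • (X ^ (b : ℕ) : R[X]) with hr
  have hrd : r.degree < i := by
    rw [← mem_degreeLT, hr]
    refine sum_mem fun b _ => Submodule.smul_mem _ _ ?_
    rw [mem_degreeLT, degree_X_pow]
    exact_mod_cast b.2
  have hq : (X ^ i - r).natDegree = i := by
    apply natDegree_eq_of_degree_eq_some
    rw [degree_sub_eq_left_of_degree_lt] <;> rw [degree_X_pow]
    exact hrd
  refine ⟨X ^ i - r, monic_X_pow_sub hrd, hq, fun m hm => ?_⟩
  have := congrFun hHc ⟨m, hm⟩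
  simp only [Matrix.mulVec, dotProduct, hankelMatrix, Matrix.of_apply] at this
  rw [sub_mul, map_sub, ← pow_add, ← this, hr, Finset.sum_mul, map_sum, sub_eq_zero]
  refine Finset.sum_congr rfl fun b _ => ?_
  rw [smul_mul_assoc, map_smul, ← pow_add, smul_eq_mul, mul_comm, add_comm m]

/-- Writing the second factor q as X ^ i plus lower terms, the lower terms are killed by the
orthogonality of the first. -/
theorem map_shift_mul_shift {q : R[X]} {i l : ℕ} (hq : q.Monic) (hd : q.natDegree = i)
    (h : ∀ m < i + l, L (q * X ^ m) = 0) {a b : ℕ} (hab : a + b ≤ l) :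
    L (X ^ a * q * (X ^ b * q)) = L (q * X ^ (i + (a + b))) := by
  have hr : (q - X ^ i).degree < (i : WithBot ℕ) := by
    have := degree_sub_lt_left (p := q) (q := X ^ i)
      (by rw [degree_X_pow, degree_eq_natDegree hq.ne_zero, hd])
      hq.ne_zero (by simp [hq.leadingCoeff])
    rwa [degree_eq_natDegree hq.ne_zero, hd] at this
  have : X ^ a * q * (X ^ b * q) = q * X ^ (i + (a + b)) + q * ((q - X ^ i) * X ^ (a + b)) := by
    ring
  rw [this, map_add, add_eq_left]
  apply map_mul_eq_zero_of_degree_lt h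
  rw [mem_degreeLT, degree_mul, degree_X_pow]
  have h2 : ((i + l : ℕ) : WithBot ℕ) = (i : WithBot ℕ) + (l : ℕ) := by push_cast; rfl
  rw [h2]
  exact WithBot.add_lt_add_of_lt_of_le (by simp) hr (by exact_mod_cast hab)

/-- In the basis 1, …, X^(i-1), q, Xq, …, X^l q the Gram matrix is block diagonal, and its second
block is antitriangular. -/
theorem det_hankelMatrix_add {q : R[X]} {i l : ℕ} (hq : q.Monic) (hd : q.natDegree = i)
    (h : ∀ m < i + l, L (q * X ^ m) = 0) :
    (hankelMatrix L (i + (l + 1))).det = (hankelMatrix L i).det *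
      (((Equiv.Perm.sign (Fin.revPerm : Equiv.Perm (Fin (l + 1))) : ℤ) : R) *
        L (q * X ^ (i + l)) ^ (l + 1)) := by
  set w : ℕ → R[X] := fun a => if a < i then X ^ a else X ^ (a - i) * q with hw
  have hw1 : ∀ a, a < i → w a = X ^ a := fun a ha => by simp [hw, ha]
  have hw2 : ∀ a, w (i + a) = X ^ a * q := fun a => by simp [hw]
  have hwm : ∀ a, (w a).Monic := fun a => by
    rcases lt_or_ge a i with ha | ha
    · rw [hw1 a ha]; exact monic_X_pow a
    · obtain ⟨b, rfl⟩ := Nat.exists_eq_add_of_le ha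
      rw [hw2]; exact (monic_X_pow b).mul hq
  have hwd : ∀ a, (w a).natDegree = a := fun a => by
    rcases lt_or_ge a i with ha | ha
    · rw [hw1 a ha, natDegree_X_pow]
    · obtain ⟨b, rfl⟩ := Nat.exists_eq_add_of_le ha
      rw [hw2, (monic_X_pow b).natDegree_mul hq, natDegree_X_pow, hd, add_comm]
  rw [← det_gram_of_monic hwm hwd, ← Matrix.det_submatrix_equiv_self finSumFinEquiv]
  set A : Matrix (Fin (l + 1)) (Fin (l + 1)) R := Matrix.of fun a b =>
    L (X ^ (a : ℕ) * q * (X ^ (b : ℕ) * q)) with hA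
  have hz : ∀ (a : Fin i) (b : Fin (l + 1)), L (q * X ^ ((b : ℕ) + a)) = 0 := fun a b =>
    h _ (by omega)
  have hblock : (Matrix.of fun a b : Fin (i + (l + 1)) => L (w a * w b)).submatrix finSumFinEquiv
      finSumFinEquiv = Matrix.fromBlocks (hankelMatrix L i) 0 0 A := by
    ext a b
    rcases a with a | a <;> rcases b with b | b
    · simp [hw1, hankelMatrix, pow_add]
    · simp only [Matrix.submatrix_apply, finSumFinEquiv_apply_left, finSumFinEquiv_apply_right,
        Matrix.of_apply, Fin.val_castAdd, Fin.val_natAdd, hw1 _ a.2, hw2,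
        Matrix.fromBlocks_apply₁₂, Matrix.zero_apply]
      rw [← hz a b]
      congr 1
      ring
    · simp only [Matrix.submatrix_apply, finSumFinEquiv_apply_left, finSumFinEquiv_apply_right,
        Matrix.of_apply, Fin.val_castAdd, Fin.val_natAdd, hw1 _ b.2, hw2,
        Matrix.fromBlocks_apply₂₁, Matrix.zero_apply]
      rw [← hz b a]
      congr 1
      ring
    · simp [hw2, hA]
  rw [hblock, Matrix.det_fromBlocks_zero₂₁, Matrix.det_antitriangular A (t := L (q * X ^ (i + l)))]
  · intro a b hab
    rw [hA, Matrix.of_apply, map_shift_mul_shift hq hd h (by omega)]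
    exact h _ (by omega)
  · intro a b hab
    rw [hA, Matrix.of_apply, map_shift_mul_shift hq hd h (by omega)]
    congr 3
    omega

/-- The contribution to the signature of the passage from a nonzero leading principal minor of
sign `ε` of a Hankel matrix to the next nonzero one, of sign `d` and larger by `k` in order. -/
def frobeniusStep (k : ℕ) (ε d : SignType) : ℤ :=
  if Odd k then (ε * d : ℤ) * (Equiv.Perm.sign (Fin.revPerm : Equiv.Perm (Fin k)) : ℤ) else 0

variable [LinearOrder R] [IsStrictOrderedRing R]

/-- For odd k, t ^ k has the sign of t, so the signs of two successive nonzero minors recover the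
sign of t. -/
theorem frobeniusStep_eq_sign {k : ℕ} (hk : Odd k) {D t : R} (hD : D ≠ 0) (σ : ℤˣ) :
    ((SignType.sign D : SignType) *
      (SignType.sign (D * (((σ : ℤ) : R) * t ^ k)) : SignType) : ℤ) * (σ : ℤ) =
      SignType.sign t := by
  have h1 : SignType.sign (t ^ k) = SignType.sign t := by
    rcases lt_trichotomy t 0 with h | rfl | h
    · rw [sign_neg h, sign_neg (hk.pow_neg h)]
    · rw [zero_pow hk.pos.ne']
    · rw [sign_pos h, sign_pos (pow_pos h k)]
  rw [sign_mul, sign_mul, h1]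
  rcases Int.units_eq_one_or σ with rfl | rfl <;> rcases hD.lt_or_gt with h | h <;>
    simp [h]

theorem hasInertia_hankelForm_add {i k : ℕ} (hk : 0 < k) (hi : (hankelMatrix L i).det ≠ 0)
    (h0 : ∀ m, i < m → m < i + k → (hankelMatrix L m).det = 0)
    (hj : (hankelMatrix L (i + k)).det ≠ 0) {s : ℤ}
    (h : (hankelForm L).HasInertia (degreeLT R i) s i) :
    (hankelForm L).HasInertia (degreeLT R (i + k))
      (s + frobeniusStep k (SignType.sign (hankelMatrix L i).det)
        (SignType.sign (hankelMatrix L (i + k)).det)) (i + k) := by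
  obtain ⟨q, hq, hd, hort⟩ := exists_orthogonal_monic hi
  obtain ⟨k, rfl⟩ := Nat.exists_eq_succ_of_ne_zero hk.ne'
  -- From here k is one less than the gap. Each vanishing minor, of order i + l + 1, forces L (q * X
  -- ^ (i + l)) = 0 and so extends the orthogonality of q by one degree.
  have hz : ∀ l ≤ k, ∀ m < i + l, L (q * X ^ m) = 0 := by
    intro l
    induction l with
    | zero => simpa using hort
    | succ l ih =>
      intro hl m hm
      have hm' := ih (by omega)
      rcases (show m < i + l ∨ m = i + l by omega) with h | rfl
      · exact hm' m h
      · have := det_hankelMatrix_add hq hd hm'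
        rw [h0 _ (by omega) (by omega)] at this
        rcases Int.units_eq_one_or (Equiv.Perm.sign (Fin.revPerm : Equiv.Perm (Fin (l + 1))))
          with h | h <;> simpa [h, hi] using this
  have hz := hz k le_rfl
  have hdet := det_hankelMatrix_add hq hd hz
  set t := L (q * X ^ (i + k)) with htdef
  have ht : t ≠ 0 := by
    rintro ht
    rw [Nat.succ_eq_add_one, hdet, ht] at hj
    simp at hj
  have hanti := LinearMap.BilinForm.hasInertia_antitriangular (hankelForm_comm L) ht (k + 1)
    (fun a => X ^ a * q) (fun a b hab => by
      rw [hankelForm_apply, map_shift_mul_shift hq hd hz (by omega)]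
      exact hz _ (by omega)) (fun a b hab => by
      rw [hankelForm_apply, map_shift_mul_shift hq hd hz (by omega), htdef]
      congr 3
      omega)
  have hperp : ∀ x ∈ degreeLT R i, ∀ y ∈ Submodule.span R ((fun a => X ^ a * q) '' Set.Iio (k + 1)),
      hankelForm L x y = 0 := by
    intro x hx y hy
    induction hy using Submodule.span_induction with
    | zero => simp
    | add y y' _ _ hy hy' => rw [map_add, hy, hy', add_zero]
    | smul c y _ hy => rw [map_smul, hy, smul_zero]
    | mem y hy =>
      obtain ⟨a, ha, rfl⟩ := hy
      have : x * (X ^ a * q) = q * (x * X ^ a) := by ring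
      rw [hankelForm_apply, this]
      apply map_mul_eq_zero_of_degree_lt hz
      rw [mem_degreeLT] at hx ⊢
      rw [degree_mul, degree_X_pow, Nat.cast_add]
      simp only [Set.mem_Iio] at ha
      exact WithBot.add_lt_add_of_lt_of_le (by simp) hx (by exact_mod_cast (by omega : a ≤ k))
  have hsum := h.sup hanti hperp (fun x hx y hy => by rw [hankelForm_comm, hperp x hx y hy])
  have hstep : frobeniusStep (k + 1) (SignType.sign (hankelMatrix L i).det)
      (SignType.sign (hankelMatrix L (i + (k + 1))).det) =
      if Odd (k + 1) then (SignType.sign t : ℤ) else 0 := by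
    rw [frobeniusStep]
    split_ifs with hodd
    · rw [hdet, frobeniusStep_eq_sign hodd hi]
    · rfl
  rw [Nat.succ_eq_add_one, hstep]
  refine hsum.mono (sup_le (degreeLT_mono (by omega)) ?_)
  rw [Submodule.span_le]
  rintro _ ⟨a, ha, rfl⟩
  simp only [Set.mem_Iio] at ha
  simp only [SetLike.mem_coe, mem_degreeLT, degree_mul, degree_X_pow,
    degree_eq_natDegree hq.ne_zero, hd]
  exact_mod_cast (by omega : a + i < i + (k + 1))

/-- Reading the signs `τ 1, τ 2, …, τ n` of the leading principal minors of a Hankel matrix: the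
distance from the last nonzero minor to `n + 1`, the sign of that minor, and the signature of the
corresponding leading principal submatrix. -/
def frobeniusState (τ : ℕ → SignType) : ℕ → ℕ × SignType × ℤ
  -- The empty minor, of order 0, is 1; it lies at distance 1 from order 1.
  | 0 => (1, 1, 0)
  | n + 1 =>
    if τ (n + 1) = 0 then
      ((frobeniusState τ n).1 + 1, (frobeniusState τ n).2)
    else
      (1, τ (n + 1), (frobeniusState τ n).2.2 +
        frobeniusStep (frobeniusState τ n).1 (frobeniusState τ n).2.1 (τ (n + 1)))

theorem frobeniusState_congr {τ τ' : ℕ → SignType} {n : ℕ} (h : ∀ m ≤ n, τ m = τ' m) :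
    frobeniusState τ n = frobeniusState τ' n := by
  induction n with
  | zero => rfl
  | succ n ih => simp only [frobeniusState, h (n + 1) le_rfl, ih fun m hm => h m (by omega)]

/-- Frobenius' rule: the signs of the leading principal minors of a Hankel matrix determine the
signature of its largest nonsingular leading principal submatrix. -/
theorem exists_hasInertia_frobeniusState (L : R[X] →ₗ[R] R) (n : ℕ) :
    ∃ i, i + (frobeniusState (fun m => SignType.sign (hankelMatrix L m).det) n).1 = n + 1 ∧
      0 < (frobeniusState (fun m => SignType.sign (hankelMatrix L m).det) n).1 ∧
      (hankelMatrix L i).det ≠ 0 ∧ SignType.sign (hankelMatrix L i).det =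
        (frobeniusState (fun m => SignType.sign (hankelMatrix L m).det) n).2.1 ∧
      (∀ m, i < m → m ≤ n → (hankelMatrix L m).det = 0) ∧
      (hankelForm L).HasInertia (degreeLT R i)
        (frobeniusState (fun m => SignType.sign (hankelMatrix L m).det) n).2.2 i := by
  induction n with
  | zero =>
    refine ⟨0, rfl, one_pos, ?_, ?_, fun m h h' => by omega,
      LinearMap.BilinForm.hasInertia_zero _ _⟩ <;> simp [frobeniusState]
  | succ n ih =>
    obtain ⟨i, h1, h2, h3, h4, h5, h6⟩ := ih
    set st := frobeniusState (fun m => SignType.sign (hankelMatrix L m).det) n with hst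
    by_cases h : (hankelMatrix L (n + 1)).det = 0
    · refine ⟨i, ?_⟩
      simp only [frobeniusState, h, sign_zero, if_true, ← hst]
      refine ⟨by omega, by omega, h3, h4, fun m hm hm' => ?_, h6⟩
      rcases (show m ≤ n ∨ m = n + 1 by omega) with hm' | rfl
      exacts [h5 m hm hm', h]
    · refine ⟨n + 1, ?_⟩
      simp only [frobeniusState, sign_eq_zero_iff, h, if_false, ← hst]
      refine ⟨trivial, one_pos, h, trivial, fun m hm hm' => by omega, ?_⟩
      have := hasInertia_hankelForm_add h2 h3 (fun m hm hm' => h5 m hm (by omega)) (h1 ▸ h) h6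
      rwa [h1, h4] at this

end Polynomial

/-! ### Traces in R[X]/(P) as sums over roots -/

section Trace

variable {K : Type*} [Field K] [IsAlgClosed K]

/-- On the generalized eigenspace of μ, φ is μ plus a nilpotent, so φ ^ k has trace μ ^ k times the
dimension, which is the multiplicity of μ. -/
theorem LinearMap.trace_pow_eq_sum_rootMultiplicity {V : Type*} [AddCommGroup V] [Module K V]
    [FiniteDimensional K V] (φ : Module.End K V) (k : ℕ) :
    LinearMap.trace K V (φ ^ k) =
      ∑ᶠ x, (φ.charpoly.rootMultiplicity x : K) * x ^ k := by
  classical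
  have hds := DirectSum.isInternal_submodule_of_iSupIndep_of_iSup_eq_top
    φ.independent_maxGenEigenspace φ.iSup_maxGenEigenspace_eq_top
  have h_fin : {μ | φ.maxGenEigenspace μ ≠ ⊥}.Finite :=
    WellFoundedGT.finite_ne_bot_of_iSupIndep φ.independent_maxGenEigenspace
  have hmaps := fun μ => φ.mapsTo_maxGenEigenspace_of_comm (Commute.refl φ) μ
  have hmaps' := fun μ => φ.mapsTo_maxGenEigenspace_of_comm ((Commute.refl φ).pow_right k) μ
  rw [LinearMap.trace_eq_sum_trace_restrict' hds h_fin hmaps', finsum_eq_sum_of_support_subset]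
  · refine Finset.sum_congr rfl fun μ _ => ?_
    rw [← LinearMap.finrank_maxGenEigenspace_eq]
    have hpow : (φ ^ k).restrict (hmaps' μ) = (φ.restrict (hmaps μ)) ^ k :=
      (Module.End.pow_restrict k (hmaps μ) (hmaps' μ)).symm
    rw [hpow]
    have hnil := φ.isNilpotent_restrict_maxGenEigenspace_sub_algebraMap μ
    clear hpow hmaps'
    induction k with
    | zero => simp
    | succ k ih =>
      rw [pow_succ]
      have := LinearMap.trace_comp_eq_mul_of_commute_of_isNilpotent μ
        ((Commute.refl (φ.restrict (hmaps μ))).pow_left k) hnil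
      rw [Module.End.mul_eq_comp, this, ih]
      ring
  · intro x hx
    simp only [Set.Finite.coe_toFinset, Set.mem_ofPred_eq]
    intro h
    apply hx
    have h2 := φ.finrank_maxGenEigenspace_eq x
    rw [h, finrank_bot] at h2
    simp [← h2]

theorem LinearMap.trace_aeval_eq_sum_roots {V : Type*} [AddCommGroup V] [Module K V]
    [FiniteDimensional K V] [DecidableEq K] (φ : Module.End K V) (f : K[X]) :
    LinearMap.trace K V (aeval φ f) =
      ∑ x ∈ φ.charpoly.roots.toFinset, (φ.charpoly.rootMultiplicity x : K) * f.eval x := by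
  induction f using Polynomial.induction_on' with
  | add f g hf hg => simp [hf, hg, mul_add, Finset.sum_add_distrib]
  | monomial k c =>
    rw [aeval_monomial, Module.algebraMap_end_eq_smul_id, ← Module.End.one_eq_id,
      smul_mul_assoc, one_mul, map_smul,
      LinearMap.trace_pow_eq_sum_rootMultiplicity, finsum_eq_sum_of_support_subset
        (s := φ.charpoly.roots.toFinset), smul_eq_mul, Finset.mul_sum]
    · refine Finset.sum_congr rfl fun x _ => ?_
      rw [eval_monomial]
      ring
    · intro x hx
      simp only [Finset.mem_coe, Multiset.mem_toFinset, ← Multiset.count_pos, count_roots]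
      rw [Nat.pos_iff_ne_zero]
      rintro h
      simp [h] at hx

/-- Multiplication by the class of X has characteristic polynomial P made monic; the trace is
computed after extending scalars to K. -/
theorem AdjoinRoot.algebraMap_trace_mk {R : Type*} [Field R] [Algebra R K] [DecidableEq K]
    {P : R[X]} (hP : P ≠ 0) (f : R[X]) :
    algebraMap R K (Algebra.trace R (AdjoinRoot P) (AdjoinRoot.mk P f)) =
      ∑ x ∈ (P.map (algebraMap R K)).roots.toFinset,
        ((P.map (algebraMap R K)).rootMultiplicity x : K) * aeval x f := by
  set pb := AdjoinRoot.powerBasis hP with hpb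
  set M := Algebra.leftMulMatrix pb.basis pb.gen with hM
  have h1 : Algebra.leftMulMatrix pb.basis (AdjoinRoot.mk P f) = aeval M f := by
    rw [← AdjoinRoot.aeval_eq, hM, aeval_algHom_apply]
    rfl
  have h2 : M.charpoly = P * C P.leadingCoeff⁻¹ := by
    rw [hM, charpoly_leftMulMatrix, hpb, AdjoinRoot.minpoly_powerBasis_gen]
  have hlc : algebraMap R K P.leadingCoeff⁻¹ ≠ 0 := by simpa using hP
  set φ : Module.End K (Fin pb.dim → K) := Matrix.toLin' (M.map (algebraMap R K)) with hφ
  have h3 : φ.charpoly = P.map (algebraMap R K) * C (algebraMap R K P.leadingCoeff⁻¹) := by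
    rw [hφ, Matrix.charpoly_toLin', Matrix.charpoly_map, h2, Polynomial.map_mul, map_C]
  have h4 : (aeval M f).map (algebraMap R K) =
      aeval (M.map (algebraMap R K)) (f.map (algebraMap R K)) := by
    have := aeval_algHom_apply (Algebra.ofId R K).mapMatrix M f
    rw [aeval_map_algebraMap]
    exact this.symm
  have h5 := LinearMap.trace_aeval_eq_sum_roots φ (f.map (algebraMap R K))
  have h6 : aeval φ (f.map (algebraMap R K)) =
      Matrix.toLin' ((aeval M f).map (algebraMap R K)) := by
    rw [h4, hφ]
    exact aeval_algHom_apply (Matrix.toLinAlgEquiv' (R := K)).toAlgHom _ _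
  have h7 : (P.map (algebraMap R K) * C (algebraMap R K P.leadingCoeff⁻¹)).roots =
      (P.map (algebraMap R K)).roots := by rw [mul_comm, roots_C_mul _ hlc]
  rw [h6, Matrix.trace_toLin'_eq, h3, h7] at h5
  rw [Algebra.trace_eq_matrix_trace pb.basis, h1]
  have h8 : algebraMap R K (aeval M f).trace = ((aeval M f).map (algebraMap R K)).trace :=
    AddMonoidHom.map_trace (algebraMap R K : R →+ K) _
  rw [h8, h5]
  refine Finset.sum_congr rfl fun x _ => ?_
  rw [← count_roots, h7, count_roots, eval_map_algebraMap]

end Trace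

/-! ### Hermite's theorem: signature equals Tarski query -/

namespace Polynomial

variable {R : Type*} [Field R]

/-- The functional `f ↦ Tr (Q f)` on polynomials, where the trace is taken in `R[X] / (P)`. -/
def hermiteFunctional (P Q : R[X]) : R[X] →ₗ[R] R :=
  Algebra.trace R (AdjoinRoot P) ∘ₗ (aeval (AdjoinRoot.root P)).toLinearMap ∘ₗ
    LinearMap.mulLeft R Q

theorem hermiteFunctional_apply (P Q f : R[X]) :
    hermiteFunctional P Q f = Algebra.trace R (AdjoinRoot P) (AdjoinRoot.mk P (Q * f)) := by
  simp [hermiteFunctional, AdjoinRoot.aeval_eq]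

theorem hmi_eq_det_hankelMatrix (P Q : R[X]) (j : ℕ) :
    SignDetermination.hmi P Q j =
      (hankelMatrix (hermiteFunctional P Q) (P.natDegree - j)).det := by
  rw [SignDetermination.hmi]
  congr 1
  ext a b
  simp [SignDetermination.her, hankelMatrix, hermiteFunctional_apply]

section AlgClosed

variable (K : Type*) [Field K] [Algebra R K] [DecidableEq K]

/-- The roots of `P` in `K` that are not roots of `Q`. -/
def essentialRoots (P Q : R[X]) : Finset K :=
  (P.map (algebraMap R K)).roots.toFinset.filter fun x => aeval x Q ≠ 0

variable {K}

theorem card_essentialRoots_le (P Q : R[X]) : (essentialRoots K P Q).card ≤ P.natDegree :=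
  (Finset.card_filter_le _ _).trans ((Multiset.toFinset_card_le _).trans
    ((card_roots' _).trans natDegree_map_le))

variable [IsAlgClosed K]

theorem algebraMap_hermiteFunctional {P : R[X]} (hP : P ≠ 0) (Q f : R[X]) :
    algebraMap R K (hermiteFunctional P Q f) = ∑ x ∈ essentialRoots K P Q,
      ((P.map (algebraMap R K)).rootMultiplicity x : K) * aeval x Q * aeval x f := by
  rw [hermiteFunctional_apply, AdjoinRoot.algebraMap_trace_mk hP, essentialRoots, Finset.sum_filter]
  refine Finset.sum_congr rfl fun x _ => ?_
  split_ifs with h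
  · rw [map_mul, mul_assoc]
  · rw [not_not] at h
    simp [h]

/-- Over K the matrix is VᵀDV, with V the Vandermonde matrix of the essential roots and D diagonal
with nonzero entries. -/
theorem det_hankelMatrix_card_essentialRoots_ne_zero [CharZero R] {P : R[X]} (hP : P ≠ 0)
    (Q : R[X]) : (hankelMatrix (hermiteFunctional P Q) (essentialRoots K P Q).card).det ≠ 0 := by
  have : CharZero K := charZero_of_injective_algebraMap (algebraMap R K).injective
  set S := essentialRoots K P Q with hS
  let e := S.equivFin.symm
  let v : Fin S.card → K := fun i => e i
  let c : Fin S.card → K := fun i =>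
    ((P.map (algebraMap R K)).rootMultiplicity (v i) : K) * aeval (v i) Q
  have hmat : (algebraMap R K).mapMatrix (hankelMatrix (hermiteFunctional P Q) S.card) =
      (Matrix.vandermonde v).transpose * Matrix.diagonal c * Matrix.vandermonde v := by
    ext a b
    simp only [RingHom.mapMatrix_apply, Matrix.map_apply, hankelMatrix, Matrix.of_apply,
      algebraMap_hermiteFunctional (K := K) hP]
    rw [Matrix.mul_apply, ← hS, ← Finset.sum_coe_sort, ← e.sum_comp]
    refine Finset.sum_congr rfl fun i _ => ?_
    simp [Matrix.vandermonde_apply, Matrix.mul_diagonal, v, c, pow_add]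
    ring
  intro h
  have h2 := congrArg Matrix.det hmat
  rw [← RingHom.map_det, h, map_zero, Matrix.det_mul, Matrix.det_mul, Matrix.det_transpose,
    Matrix.det_diagonal] at h2
  have h3 : (Matrix.vandermonde v).det ≠ 0 := Matrix.det_vandermonde_ne_zero_iff.mpr
    (Subtype.val_injective.comp e.injective)
  have h4 : ∏ i, c i ≠ 0 := Finset.prod_ne_zero_iff.mpr fun i _ => by
    have : v i ∈ essentialRoots K P Q := (e i).2
    rw [essentialRoots, Finset.mem_filter, Multiset.mem_toFinset, ← Multiset.count_pos,
      count_roots] at this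
    exact mul_ne_zero (Nat.cast_ne_zero.mpr this.1.ne') this.2
  exact mul_ne_zero (mul_ne_zero h3 h4) h3 h2.symm

end AlgClosed

section RealClosed

/-- Applied to conjugation: identities over the roots in R[i] are checked on x and its conjugate
together, with no choice of representatives. -/
theorem _root_.Finset.sum_eq_zero_of_involution {ι M : Type*} [Field M] [CharZero M]
    {s : Finset ι} (σ : ι → ι) (hσ : ∀ x, σ (σ x) = x) (hs : ∀ x ∈ s, σ x ∈ s) (u : ι → M)
    (hu : ∀ x ∈ s, u x + u (σ x) = 0) : ∑ x ∈ s, u x = 0 := by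
  have h : ∑ x ∈ s, u x = ∑ x ∈ s, u (σ x) :=
    Finset.sum_nbij' σ σ hs hs (fun x _ => hσ x) (fun x _ => hσ x) (fun x _ => by rw [hσ])
  have h2 : ∑ x ∈ s, u x + ∑ x ∈ s, u x = 0 := by
    conv_lhs => rw [h]
    conv_lhs => enter [1]; rw [← h]
    rw [← Finset.sum_add_distrib]
    exact Finset.sum_eq_zero hu
  exact add_self_eq_zero.mp h2

theorem starRingEnd_comp_algebraMap : (starRingEnd (QuadraticAlgebra R (-1) 0)).comp
    (algebraMap R (QuadraticAlgebra R (-1) 0)) = algebraMap R (QuadraticAlgebra R (-1) 0) := by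
  ext r <;> simp [QuadraticAlgebra.algebraMap_eq, starRingEnd_apply]

variable [LinearOrder R] [IsStrictOrderedRing R]

theorem aeval_star (x : QuadraticAlgebra R (-1) 0) (f : R[X]) :
    aeval (star x) f = star (aeval x f) := by
  have h := hom_eval₂ f (algebraMap R (QuadraticAlgebra R (-1) 0))
    (starRingEnd (QuadraticAlgebra R (-1) 0)) x
  rw [starRingEnd_comp_algebraMap] at h
  exact h.symm

theorem rootMultiplicity_star (P : R[X]) (x : QuadraticAlgebra R (-1) 0) :
    (P.map (algebraMap R (QuadraticAlgebra R (-1) 0))).rootMultiplicity (star x) =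
      (P.map (algebraMap R (QuadraticAlgebra R (-1) 0))).rootMultiplicity x := by
  have h := eq_rootMultiplicity_map (p := P.map (algebraMap R (QuadraticAlgebra R (-1) 0)))
    (f := starRingEnd (QuadraticAlgebra R (-1) 0))
    (starRingEnd (QuadraticAlgebra R (-1) 0)).injective x
  rw [Polynomial.map_map, starRingEnd_comp_algebraMap] at h
  exact h.symm

variable [DecidableEq (QuadraticAlgebra R (-1) 0)]

theorem star_mem_essentialRoots {P Q : R[X]} {x : QuadraticAlgebra R (-1) 0}
    (hx : x ∈ essentialRoots (QuadraticAlgebra R (-1) 0) P Q) :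
    star x ∈ essentialRoots (QuadraticAlgebra R (-1) 0) P Q := by
  simp only [essentialRoots, Finset.mem_filter, Multiset.mem_toFinset, ← Multiset.count_pos,
    count_roots, rootMultiplicity_star, aeval_star, ne_eq, star_eq_zero] at hx ⊢
  exact hx

/-- The coefficients of the Hermite form, diagonalized over the conjugate pairs of roots. -/
def hermiteCoeff (P Q : R[X]) (x : QuadraticAlgebra R (-1) 0) : R :=
  if x.im = 0 then
    (P.map (algebraMap R (QuadraticAlgebra R (-1) 0))).rootMultiplicity x * (aeval x Q).re
  else if 0 < x.im then 2 * (P.map (algebraMap R (QuadraticAlgebra R (-1) 0))).rootMultiplicity x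
  else -(2 * (P.map (algebraMap R (QuadraticAlgebra R (-1) 0))).rootMultiplicity x)

theorem rootMultiplicity_pos_of_mem_essentialRoots {P Q : R[X]}
    {x : QuadraticAlgebra R (-1) 0} (hx : x ∈ essentialRoots (QuadraticAlgebra R (-1) 0) P Q) :
    0 < (P.map (algebraMap R (QuadraticAlgebra R (-1) 0))).rootMultiplicity x := by
  rw [essentialRoots, Finset.mem_filter, Multiset.mem_toFinset, ← Multiset.count_pos,
    count_roots] at hx
  exact hx.1

theorem sum_sign_hermiteCoeff {P : R[X]} (hP : P ≠ 0) (Q : R[X]) :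
    ∑ x ∈ essentialRoots (QuadraticAlgebra R (-1) 0) P Q,
      (SignType.sign (hermiteCoeff P Q x) : ℤ) =
    ∑ θ ∈ P.roots.toFinset, (SignType.sign (Q.eval θ) : ℤ) := by
  classical
  -- Conjugate roots have opposite coefficients. The cast to ℚ is there because the involution lemma
  -- wants a field.
  have h1 : ∑ x ∈ (essentialRoots (QuadraticAlgebra R (-1) 0) P Q).filter (fun x => ¬ x.im = 0),
      ((SignType.sign (hermiteCoeff P Q x) : ℤ) : ℚ) = 0 := by
    refine Finset.sum_eq_zero_of_involution star star_star ?_ _ ?_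
    · intro x hx
      rw [Finset.mem_filter] at hx ⊢
      exact ⟨star_mem_essentialRoots hx.1, by simpa using hx.2⟩
    · intro x hx
      rw [Finset.mem_filter] at hx
      have hm := rootMultiplicity_pos_of_mem_essentialRoots hx.1
      have hm' : (0 : R) < 2 *
        (P.map (algebraMap R (QuadraticAlgebra R (-1) 0))).rootMultiplicity x := by positivity
      rcases lt_or_gt_of_ne hx.2 with h | h
      · simp only [hermiteCoeff, QuadraticAlgebra.im_star, rootMultiplicity_star, neg_eq_zero,
          Left.neg_pos_iff, h.ne, h, h.not_gt, if_true, if_false, Left.sign_neg, sign_pos hm']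
        simp
      · simp only [hermiteCoeff, QuadraticAlgebra.im_star, rootMultiplicity_star, neg_eq_zero,
          Left.neg_pos_iff, h.ne', h, h.not_gt, if_true, if_false, Left.sign_neg, sign_pos hm']
        simp
  rw [← Finset.sum_filter_add_sum_filter_not _ (fun x => x.im = 0), (by exact_mod_cast h1 :
    ∑ x ∈ (essentialRoots (QuadraticAlgebra R (-1) 0) P Q).filter (fun x => ¬ x.im = 0),
      (SignType.sign (hermiteCoeff P Q x) : ℤ) = 0), add_zero,
    ← Finset.sum_filter_of_ne (s := P.roots.toFinset) (p := fun θ => Q.eval θ ≠ 0)]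
  · have hmem : ∀ θ : R, algebraMap R (QuadraticAlgebra R (-1) 0) θ ∈
        essentialRoots (QuadraticAlgebra R (-1) 0) P Q ↔ P.eval θ = 0 ∧ Q.eval θ ≠ 0 := fun θ => by
      rw [essentialRoots, Finset.mem_filter, Multiset.mem_toFinset, mem_roots_map hP,
        ← aeval_def, aeval_algebraMap_apply, aeval_algebraMap_apply, ne_eq,
        FaithfulSMul.algebraMap_eq_zero_iff, FaithfulSMul.algebraMap_eq_zero_iff,
        coe_aeval_eq_eval]
    have halg : ∀ x : QuadraticAlgebra R (-1) 0, x.im = 0 → algebraMap R _ x.re = x :=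
        fun x hx => by
      ext <;> simp [QuadraticAlgebra.algebraMap_eq, hx]
    refine Finset.sum_nbij' (fun x => x.re) (algebraMap R (QuadraticAlgebra R (-1) 0))
      ?_ ?_ ?_ ?_ ?_
    · intro x hx
      rw [Finset.mem_filter] at hx
      have := hx.1
      rw [← halg x hx.2, hmem] at this
      simpa [hP] using this
    · intro θ hθ
      rw [Finset.mem_filter, hmem]
      simpa [hP] using hθ
    · intro x hx
      exact halg x (Finset.mem_filter.mp hx).2
    · intro θ _
      rfl
    · intro x hx
      rw [Finset.mem_filter] at hx
      have hm := rootMultiplicity_pos_of_mem_essentialRoots hx.1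
      rw [hermiteCoeff, if_pos hx.2, sign_mul, sign_pos (Nat.cast_pos.mpr hm), one_mul]
      conv_lhs => rw [← halg x hx.2, aeval_algebraMap_apply, QuadraticAlgebra.algebraMap_re]
      simp
  · intro θ _ h h'
    simp [h'] at h

variable [IsRealClosed R]

/-- A conjugate pair of multiplicity m contributes 2m Re(Q(x) f(x)²). With w² = Q(x) this is 2m
(Re(w f(x))² - Im(w f(x))²); the first square is assigned to the root in the upper half plane, the
second to its conjugate. -/
theorem exists_hermiteForm_eq_sum_sq {P : R[X]} (hP : P ≠ 0) (Q : R[X]) :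
    ∃ l : (QuadraticAlgebra R (-1) 0) → R[X] →ₗ[R] R, ∀ f, hankelForm (hermiteFunctional P Q) f f =
      ∑ x ∈ essentialRoots (QuadraticAlgebra R (-1) 0) P Q, hermiteCoeff P Q x * l x f ^ 2 := by
  choose w hw using fun z : (QuadraticAlgebra R (-1) 0) => IsRealClosed.isSquare_quadraticAlgebra z
  refine ⟨fun x => if x.im = 0 then QuadraticAlgebra.reₗ _ _ ∘ₗ (aeval x).toLinearMap
    else if 0 < x.im then
      QuadraticAlgebra.reₗ _ _ ∘ₗ LinearMap.mulLeft R (w (aeval x Q)) ∘ₗ (aeval x).toLinearMap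
    else QuadraticAlgebra.imₗ _ _ ∘ₗ LinearMap.mulLeft R (w (aeval (star x) Q)) ∘ₗ
      (aeval (star x)).toLinearMap, fun f => ?_⟩
  have hL := congrArg QuadraticAlgebra.re
    (algebraMap_hermiteFunctional (K := QuadraticAlgebra R (-1) 0) hP Q (f * f))
  rw [QuadraticAlgebra.algebraMap_re] at hL
  have hre : ∀ (s : Finset (QuadraticAlgebra R (-1) 0))
      (g : QuadraticAlgebra R (-1) 0 → QuadraticAlgebra R (-1) 0),
      (∑ x ∈ s, g x).re = ∑ x ∈ s, (g x).re := fun s g =>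
    map_sum (QuadraticAlgebra.reₗ (R := R) (-1) 0) g s
  rw [hankelForm_apply, hL, hre, ← sub_eq_zero, ← Finset.sum_sub_distrib]
  refine Finset.sum_eq_zero_of_involution star star_star (fun x => star_mem_essentialRoots) _
    fun x _ => ?_
  have hQ := hw (aeval x Q)
  have hQ' := hw (star (aeval x Q))
  simp only [map_mul, rootMultiplicity_star, hermiteCoeff, aeval_star, star_star,
    QuadraticAlgebra.im_star, neg_eq_zero, Left.neg_pos_iff]
  generalize (P.map (algebraMap R (QuadraticAlgebra R (-1) 0))).rootMultiplicity x = m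
  rcases lt_trichotomy x.im 0 with h | h | h
  · simp only [h.ne, h.not_gt, if_false, h, if_true, LinearMap.comp_apply,
      AlgHom.toLinearMap_apply, LinearMap.mulLeft_apply, aeval_star]
    generalize w (star (aeval x Q)) = W at *
    generalize aeval x f = F at *
    generalize aeval x Q = z at *
    obtain rfl : z = star (W * W) := by rw [← hQ', star_star]
    simp [QuadraticAlgebra.reₗ, QuadraticAlgebra.imₗ]
    ring
  · have hx : star x = x := by ext <;> simp [h]
    have him : ∀ g : R[X], (aeval x g).im = 0 := fun g => by
      have := congrArg QuadraticAlgebra.im (aeval_star x g)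
      rw [hx, QuadraticAlgebra.im_star] at this
      linarith
    simp [h, QuadraticAlgebra.reₗ, him, aeval_star]
    ring
  · simp only [h.ne', h.not_gt, if_false, h, if_true, LinearMap.comp_apply,
      AlgHom.toLinearMap_apply, LinearMap.mulLeft_apply]
    generalize w (aeval x Q) = W at *
    generalize aeval x f = F at *
    generalize aeval x Q = z at *
    obtain rfl : z = W * W := hQ
    simp [QuadraticAlgebra.reₗ, QuadraticAlgebra.imₗ]
    ring

/-- Hermite's theorem with Frobenius' rule: the signs of the leading principal minors of the
Hermite matrix determine the Tarski query of `Q` for `P`. -/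
theorem frobeniusState_hermite {P : R[X]} (hP : P ≠ 0) (Q : R[X]) :
    (frobeniusState (fun m => SignType.sign (hankelMatrix (hermiteFunctional P Q) m).det)
      P.natDegree).2.2 = ∑ θ ∈ P.roots.toFinset, (SignType.sign (Q.eval θ) : ℤ) := by
  classical
  obtain ⟨i, -, -, -, -, h5, h6⟩ :=
    exists_hasInertia_frobeniusState (hermiteFunctional P Q) P.natDegree
  obtain ⟨l, hl⟩ := exists_hermiteForm_eq_sum_sq hP Q
  -- The form is a combination of at most i squares, so the inertia found in dimension i is all of
  -- it and Sylvester's law applies.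
  have hle : (essentialRoots (QuadraticAlgebra R (-1) 0) P Q).card ≤ i := by
    by_contra h
    exact det_hankelMatrix_card_essentialRoots_ne_zero hP Q
      (h5 _ (not_le.mp h) (card_essentialRoots_le P Q))
  rw [← sum_sign_hermiteCoeff hP, ← Finset.sum_coe_sort]
  refine h6.eq_sum_sign (l := fun x : essentialRoots (QuadraticAlgebra R (-1) 0) P Q => l x)
    (fun f => ?_) (by rwa [Fintype.card_coe])
  rw [hl, ← Finset.sum_coe_sort]

end RealClosed

end Polynomial

/-! ### Thom's lemma -/

namespace Polynomial

section Thom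

variable {R : Type*} [Field R] [LinearOrder R]

/-- The nonnegative combinations of the products `U ^ m * V ^ n`. -/
inductive BernsteinCone (U V : R[X]) : R[X] → Prop
  | zero : BernsteinCone U V 0
  | add {f g : R[X]} : BernsteinCone U V f → BernsteinCone U V g → BernsteinCone U V (f + g)
  | monomial {c : R} (hc : 0 ≤ c) (m n : ℕ) : BernsteinCone U V (C c * (U ^ m * V ^ n))

variable {U V f : R[X]}

theorem BernsteinCone.swap (h : BernsteinCone U V f) : BernsteinCone V U f := by
  induction h with
  | zero => exact .zero
  | add _ _ hf hg => exact hf.add hg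
  | monomial hc m n => rw [mul_comm (U ^ m)]; exact .monomial hc n m

variable [IsStrictOrderedRing R]

theorem BernsteinCone.smul {c : R} (hc : 0 ≤ c) (h : BernsteinCone U V f) :
    BernsteinCone U V (C c * f) := by
  induction h with
  | zero => rw [mul_zero]; exact .zero
  | add _ _ hf hg => rw [mul_add]; exact hf.add hg
  | monomial hd m n => rw [← mul_assoc, ← C_mul]; exact .monomial (mul_nonneg hc hd) m n

theorem BernsteinCone.eval_nonneg (h : BernsteinCone U V f) {x : R} (hU : 0 ≤ U.eval x)
    (hV : 0 ≤ V.eval x) : 0 ≤ f.eval x := by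
  induction h with
  | zero => simp
  | add _ _ hf hg => rw [eval_add]; exact add_nonneg hf hg
  | monomial hc m n =>
    simp only [eval_mul, eval_pow, eval_C]
    exact mul_nonneg hc (mul_nonneg (pow_nonneg hU m) (pow_nonneg hV n))

/-- Integration by parts lowers the exponent of V; since U and V have opposite derivatives, all
coefficients stay nonnegative. Taking ε = 1 or -1 serves integration from either endpoint. -/
theorem BernsteinCone.exists_antiderivative_monomial {ε a : R} (hU : derivative U = C ε)
    (hV : derivative V = -C ε) (ha : U.eval a = 0) (n : ℕ) : ∀ m : ℕ,
    ∃ G, BernsteinCone U V G ∧ derivative G = C ε * (U ^ m * V ^ n) ∧ G.eval a = 0 := by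
  induction n with
  | zero =>
    intro m
    have hm : ((m : R) + 1) ≠ 0 := by positivity
    refine ⟨C ((m : R) + 1)⁻¹ * (U ^ (m + 1) * V ^ 0), .monomial (by positivity) _ _, ?_, ?_⟩
    · have : (C ((m : R) + 1)⁻¹ * C ((m : R) + 1) : R[X]) = 1 := by
        rw [← C_mul, inv_mul_cancel₀ hm, C_1]
      simp [derivative_pow, hU] at this ⊢
      linear_combination (U ^ m * C ε) * this
    · simp [ha]
  | succ n ih =>
    intro m
    have hm : ((m : R) + 1) ≠ 0 := by positivity
    obtain ⟨G, hG, hG', hGa⟩ := ih (m + 1)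
    refine ⟨C ((m : R) + 1)⁻¹ * (U ^ (m + 1) * V ^ (n + 1)) +
      C (((m : R) + 1)⁻¹ * ((n : R) + 1)) * G, (BernsteinCone.monomial (by positivity) _ _).add
      (hG.smul (by positivity)), ?_, ?_⟩
    · have : (C ((m : R) + 1)⁻¹ * C ((m : R) + 1) : R[X]) = 1 := by
        rw [← C_mul, inv_mul_cancel₀ hm, C_1]
      simp [derivative_pow, hU, hV, hG'] at this ⊢
      linear_combination (U ^ m * V ^ (n + 1) * C ε) * this
    · simp [ha, hGa]

theorem BernsteinCone.exists_antiderivative {ε a : R} (hU : derivative U = C ε)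
    (hV : derivative V = -C ε) (ha : U.eval a = 0) (h : BernsteinCone U V f) :
    ∃ G, BernsteinCone U V G ∧ derivative G = C ε * f ∧ G.eval a = 0 := by
  induction h with
  | zero => exact ⟨0, .zero, by simp, by simp⟩
  | add _ _ hf hg =>
    obtain ⟨F, hF, hF', hFa⟩ := hf
    obtain ⟨G, hG, hG', hGa⟩ := hg
    exact ⟨F + G, hF.add hG, by simp [hF', hG', mul_add], by simp [hFa, hGa]⟩
  | @monomial c hc m n =>
    obtain ⟨G, hG, hG', hGa⟩ := exists_antiderivative_monomial hU hV ha n m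
    refine ⟨C c * G, hG.smul hc, ?_, by simp [hGa]⟩
    rw [derivative_C_mul, hG']
    ring

theorem BernsteinCone.of_derivative_eq {G : R[X]} {a : R} (hG : BernsteinCone U V G)
    (h : derivative G = derivative f) (ha : G.eval a = 0) (hf : 0 ≤ f.eval a) :
    BernsteinCone U V f := by
  have h0 : derivative (f - G) = 0 := by rw [derivative_sub, h, sub_self]
  have h1 := eq_C_of_natDegree_eq_zero (derivative_eq_zero.mp h0)
  have h2 : (f - G).coeff 0 = f.eval a := by
    have := congrArg (eval a) h1
    rw [eval_C, eval_sub, ha, sub_zero] at this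
    exact this.symm
  have h3 : f = G + C (f.eval a) * (U ^ 0 * V ^ 0) := by
    rw [h2] at h1
    rw [pow_zero, pow_zero, mul_one, mul_one, ← h1]
    ring
  rw [h3]
  exact hG.add (.monomial hf 0 0)

/-- A polynomial all of whose derivatives have the same signs at `a` and `b`, and which is
nonnegative there, is a nonnegative combination of the `(X - a) ^ m * (b - X) ^ n`. -/
theorem bernsteinCone_of_sign_eq {a b : R} (n : ℕ) : ∀ f : R[X], f.natDegree ≤ n →
    (∀ k, SignType.sign ((derivative^[k] f).eval a) = SignType.sign ((derivative^[k] f).eval b)) →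
    0 ≤ f.eval a → BernsteinCone (X - C a) (C b - X) f := by
  induction n with
  | zero =>
    intro f hf _ ha
    rw [eq_C_of_natDegree_le_zero hf] at ha ⊢
    rw [eval_C] at ha
    simpa using BernsteinCone.monomial (U := X - C a) (V := C b - X) ha 0 0
  | succ n ih =>
    intro f hf h ha
    have hb : 0 ≤ f.eval b := by
      have := h 0
      rw [Function.iterate_zero_apply] at this
      rw [← sign_nonneg_iff] at ha ⊢
      rwa [← this]
    have hd : (derivative f).natDegree ≤ n := by
      have := natDegree_derivative_le f
      omega
    have hsign : ∀ k, SignType.sign ((derivative^[k] (derivative f)).eval a) =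
        SignType.sign ((derivative^[k] (derivative f)).eval b) := fun k => h (k + 1)
    -- If f' is nonnegative at the ends, f is integrated from a; otherwise -f' lies in the cone and
    -- f is integrated backwards from b.
    rcases le_total 0 ((derivative f).eval a) with h0 | h0
    · obtain ⟨G, hG, hG', hGa⟩ := (ih _ hd hsign h0).exists_antiderivative (ε := 1) (a := a)
        (by simp) (by simp) (by simp)
      exact hG.of_derivative_eq (by simpa using hG') hGa ha
    · obtain ⟨G, hG, hG', hGb⟩ := (ih (-derivative f) (by rwa [natDegree_neg])
        (fun k => by
          rw [iterate_derivative_neg, eval_neg, eval_neg, Left.sign_neg, Left.sign_neg, hsign k])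
        (by simpa using h0)).swap.exists_antiderivative (ε := -1) (a := b)
        (by simp) (by simp) (by simp)
      exact hG.swap.of_derivative_eq (by simpa using hG') hGb hb

/-- Thom's lemma: a root of `P` is determined by the signs of the derivatives of `P` at it. -/
theorem eq_of_sign_derivative_eq {P : R[X]} (hP : P ≠ 0) {a b : R} (ha : P.eval a = 0)
    (hb : P.eval b = 0) (h : ∀ k, SignType.sign ((derivative^[k] P).eval a) =
      SignType.sign ((derivative^[k] P).eval b)) : a = b := by
  wlog hab : a < b generalizing a b
  · by_contra hne
    exact hne (this hb ha (fun k => (h k).symm) (lt_of_le_of_ne (not_lt.mp hab) (Ne.symm hne))).symm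
  exfalso
  -- Both P and -P lie in the cone, so P vanishes on all of [a, b].
  have h1 := bernsteinCone_of_sign_eq _ P le_rfl h ha.ge
  have h2 := bernsteinCone_of_sign_eq (a := a) (b := b) _ (-P) le_rfl
    (fun k => by
      rw [iterate_derivative_neg, eval_neg, eval_neg, Left.sign_neg, Left.sign_neg, h k])
    (by simp [ha])
  apply hP
  refine eq_zero_of_infinite_isRoot P ((Set.Icc_infinite hab).mono ?_)
  rintro x ⟨hax, hxb⟩
  have h3 := h1.eval_nonneg (x := x) (by simpa using hax) (by simpa using hxb)
  have h4 := h2.eval_nonneg (x := x) (by simpa using hax) (by simpa using hxb)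
  rw [eval_neg] at h4
  exact le_antisymm (by linarith) h3

end Thom

end Polynomial

/-! ### Sparse moments separate weights of small support -/

namespace SignDetermination

/-- The moment of exponent `α` of a weight on the sign conditions. -/
def moment {s : ℕ} (α : Fin s → Fin 3) (d : (Fin s → SignType) → ℤ) : ℤ :=
  ∑ σ, d σ * ∏ h, (σ h : ℤ) ^ (α h : ℕ)

theorem moment_sub {s : ℕ} (α : Fin s → Fin 3) (d e : (Fin s → SignType) → ℤ) :
    moment α (d - e) = moment α d - moment α e := by
  simp [moment, sub_mul]

/-- The moment of exponent `j` of `d` along the first coordinate. -/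
def fibreMoment {s : ℕ} (j : Fin 3) (d : (Fin (s + 1) → SignType) → ℤ) (σ : Fin s → SignType) : ℤ :=
  ∑ e : SignType, d (Fin.cons e σ) * (e : ℤ) ^ (j : ℕ)

theorem moment_cons {s : ℕ} (j : Fin 3) (α : Fin s → Fin 3) (d : (Fin (s + 1) → SignType) → ℤ) :
    moment (Fin.cons j α : Fin (s + 1) → Fin 3) d = moment α (fibreMoment j d) := by
  rw [moment, ← (Fin.consEquiv fun _ => SignType).sum_comp, Fintype.sum_prod_type, Finset.sum_comm]
  refine Finset.sum_congr rfl fun σ _ => ?_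
  rw [fibreMoment, Finset.sum_mul]
  refine Finset.sum_congr rfl fun e _ => ?_
  simp [Fin.consEquiv, Fin.prod_univ_succ, mul_assoc]

theorem card_filter_cons_ne_zero {s : ℕ} (j : Fin 3) (α : Fin s → Fin 3) :
    (Finset.univ.filter fun h => (Fin.cons j α : Fin (s + 1) → Fin 3) h ≠ 0).card =
      (if j ≠ 0 then 1 else 0) + (Finset.univ.filter fun h => α h ≠ 0).card := by
  rw [Fin.card_filter_univ_succ]
  simp only [Fin.cons_zero, Fin.cons_succ]
  split_ifs <;> omega

theorem filter_fibreMoment_subset {s : ℕ} (j : Fin 3) (d : (Fin (s + 1) → SignType) → ℤ) :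
    (Finset.univ.filter fun σ => fibreMoment j d σ ≠ 0) ⊆
      (Finset.univ.filter fun σ => d σ ≠ 0).image Fin.tail := by
  intro σ hσ
  rw [Finset.mem_filter] at hσ
  obtain ⟨e, -, he⟩ := Finset.exists_ne_zero_of_sum_ne_zero hσ.2
  rw [Finset.mem_image]
  exact ⟨Fin.cons e σ, by simpa using left_ne_zero_of_mul he, Fin.tail_cons _ _⟩

/-- A vanishing fibre sum with one nonzero term has a second one. -/
theorem two_mul_card_image_tail_le {s : ℕ} {d : (Fin (s + 1) → SignType) → ℤ}
    (h : fibreMoment 0 d = 0) :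
    2 * ((Finset.univ.filter fun σ => d σ ≠ 0).image
      (Fin.tail : (Fin (s + 1) → SignType) → _)).card ≤
      (Finset.univ.filter fun σ => d σ ≠ 0).card := by
  rw [Finset.card_eq_sum_card_image (Fin.tail : (Fin (s + 1) → SignType) → _)
    (Finset.univ.filter fun σ => d σ ≠ 0), mul_comm, ← smul_eq_mul]
  apply Finset.card_nsmul_le_sum
  intro σ hσ
  obtain ⟨ρ, hρ, rfl⟩ := Finset.mem_image.mp hσ
  rw [Finset.mem_filter] at hρ
  have h0 := congrFun h (Fin.tail ρ)
  have hd : d (Fin.cons (ρ 0) (Fin.tail ρ)) ≠ 0 := by rw [Fin.cons_self_tail]; exact hρ.2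
  rw [fibreMoment, ← Finset.add_sum_erase _ _ (Finset.mem_univ (ρ 0))] at h0
  have h1 : ∑ e ∈ Finset.univ.erase (ρ 0), d (Fin.cons e (Fin.tail ρ)) *
      (e : ℤ) ^ ((0 : Fin 3) : ℕ) ≠ 0 := by
    intro h1
    rw [h1] at h0
    simp at h0
    exact hρ.2 h0
  obtain ⟨e, he, hne⟩ := Finset.exists_ne_zero_of_sum_ne_zero h1
  rw [Finset.mem_erase] at he
  rw [Nat.succ_le_iff, Finset.one_lt_card]
  refine ⟨ρ, by simp [hρ.2], Fin.cons e (Fin.tail ρ), ?_, ?_⟩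
  · simpa using left_ne_zero_of_mul hne
  · intro h2
    exact he.1 (by rw [h2, Fin.cons_zero])

/-- A Vandermonde system at the nodes 0, -1, 1 on each fibre. -/
theorem eq_zero_of_fibreMoment_eq_zero {s : ℕ} {d : (Fin (s + 1) → SignType) → ℤ}
    (h : ∀ j, fibreMoment j d = 0) : d = 0 := by
  ext σ
  have hu : (Finset.univ : Finset SignType) = {0, -1, 1} := rfl
  have h0 := congrFun (h 0) (Fin.tail σ)
  have h1 := congrFun (h 1) (Fin.tail σ)
  have h2 := congrFun (h 2) (Fin.tail σ)
  simp [fibreMoment, hu] at h0 h1 h2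
  rw [← Fin.cons_self_tail σ, Pi.zero_apply]
  rcases SignType.trichotomy (σ 0) with h | h | h <;> rw [h] <;> linarith

/-- A nonzero weight on fewer than `2 ^ (k + 1)` sign conditions has a nonzero moment whose
exponent has at most `k` nonzero entries. -/
theorem exists_moment_ne_zero {s : ℕ} : ∀ {k : ℕ} {d : (Fin s → SignType) → ℤ}, d ≠ 0 →
    (Finset.univ.filter fun σ => d σ ≠ 0).card < 2 ^ (k + 1) →
    ∃ α : Fin s → Fin 3, (Finset.univ.filter fun h => α h ≠ 0).card ≤ k ∧ moment α d ≠ 0 := by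
  induction s with
  | zero =>
    intro k d hd _
    refine ⟨Fin.elim0, by simp, ?_⟩
    intro h
    apply hd
    ext σ
    rw [moment, Fintype.sum_unique, Fin.prod_univ_zero, mul_one] at h
    exact (congrArg d (Subsingleton.elim _ _)).trans h
  | succ s ih =>
    intro k d hd hcard
    -- If the zeroth fibre moment is nonzero, exponent 0 is free and the support does not grow.
    -- Otherwise some other exponent works, and the cost of one nonzero entry is paid for by halving
    -- the support.
    by_cases h0 : fibreMoment 0 d = 0
    · have hj : ∃ j, fibreMoment j d ≠ 0 := by
        by_contra! h
        exact hd (eq_zero_of_fibreMoment_eq_zero h)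
      obtain ⟨j, hj⟩ := hj
      have hj0 : j ≠ 0 := by rintro rfl; exact hj h0
      have h2 := two_mul_card_image_tail_le h0
      have h3 := Finset.card_le_card (filter_fibreMoment_subset j d)
      have h4 : 0 < (Finset.univ.filter fun σ => fibreMoment j d σ ≠ 0).card := by
        obtain ⟨σ, hσ⟩ := Function.ne_iff.mp hj
        exact Finset.card_pos.mpr ⟨σ, by simpa using hσ⟩
      rcases k with _ | k
      · omega
      · rw [pow_succ] at hcard
        obtain ⟨α, hα, hm⟩ := ih (k := k) hj (by omega)
        refine ⟨Fin.cons j α, ?_, by rwa [moment_cons]⟩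
        rw [card_filter_cons_ne_zero, if_pos hj0]
        omega
    · obtain ⟨α, hα, hm⟩ := ih (k := k) h0 (((Finset.card_le_card
        (filter_fibreMoment_subset 0 d)).trans Finset.card_image_le).trans_lt hcard)
      refine ⟨Fin.cons 0 α, ?_, by rwa [moment_cons]⟩
      rw [card_filter_cons_ne_zero]
      simpa using hα

theorem eq_of_moment_eq {s k : ℕ} {d e : (Fin s → SignType) → ℤ} (A : Finset (Fin s → SignType))
    (hd : ∀ σ, d σ ≠ 0 → σ ∈ A) (he : ∀ σ, e σ ≠ 0 → σ ∈ A) (hA : A.card < 2 ^ (k + 1))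
    (h : ∀ α : Fin s → Fin 3, (Finset.univ.filter fun h => α h ≠ 0).card ≤ k →
      moment α d = moment α e) : d = e := by
  by_contra hne
  obtain ⟨α, hα, hm⟩ := exists_moment_ne_zero (k := k) (sub_ne_zero.mpr hne) (by
    refine (Finset.card_le_card fun σ hσ => ?_).trans_lt hA
    by_contra hσA
    have h1 : d σ = 0 := by by_contra h; exact hσA (hd σ h)
    have h2 : e σ = 0 := by by_contra h; exact hσA (he σ h)
    simp [h1, h2] at hσ)
  rw [moment_sub, h α hα, sub_self] at hm
  exact hm rfl

/-- The Tarski query computed from the signs of `hmi_0, …, hmi_p`. -/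
def query {p : ℕ} (τ : Fin (p + 1) → SignType) : ℤ :=
  -- The minor of order m is hmi_(p - m).
  (frobeniusState (fun m => τ ⟨p - m, by omega⟩) p).2.2

/-! ### Weights of the roots and recovery of the signs -/

section Roots

variable {R : Type*} [Field R] [LinearOrder R] {p : ℕ}

/-- The weight on the sign conditions that sums the values of `u` at the roots of `P` with given
Thom encoding. -/
def rootWeight (p : ℕ) (P : R[X]) (u : R → ℤ) (σ : ThomCode p) : ℤ :=
  ∑ θ ∈ P.roots.toFinset with thomEncoding p P θ = σ, u θ

/-- The set of Thom encodings of the roots of `P`. -/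
def thomCodes (p : ℕ) (P : R[X]) : Finset (ThomCode p) :=
  P.roots.toFinset.image (thomEncoding p P)

theorem mem_thomCodes_of_rootWeight_ne_zero {P : R[X]} {u : R → ℤ} {σ : ThomCode p}
    (h : rootWeight p P u σ ≠ 0) : σ ∈ thomCodes p P := by
  obtain ⟨θ, hθ, -⟩ := Finset.exists_ne_zero_of_sum_ne_zero h
  rw [Finset.mem_filter] at hθ
  exact Finset.mem_image.mpr ⟨θ, hθ⟩

theorem card_thomCodes_le {P : R[X]} (hP : P.natDegree = p) : (thomCodes p P).card ≤ p :=
  Finset.card_image_le.trans ((Multiset.toFinset_card_le _).trans (hP ▸ card_roots' P))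

variable [IsStrictOrderedRing R]

theorem query_sign_hmi [IsRealClosed R] {P : R[X]} (hP0 : P ≠ 0) (hP : P.natDegree = p) (A : R[X]) :
    query (fun j : Fin (p + 1) => SignType.sign (hmi P A j)) =
      ∑ θ ∈ P.roots.toFinset, (SignType.sign (A.eval θ) : ℤ) := by
  subst hP
  rw [← frobeniusState_hermite hP0, query]
  congr 2
  apply frobeniusState_congr
  intro m hm
  simp only [hmi_eq_det_hankelMatrix]
  rw [Nat.sub_sub_self hm]

theorem sign_eval_pder {j : ℕ} (P : R[X]) (α : Exponents p j) (θ : R) :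
    (SignType.sign ((pder P α).eval θ) : ℤ) =
      ∏ h, (thomEncoding p P θ h : ℤ) ^ (α.1 h : ℕ) := by
  have h1 : SignType.sign ((pder P α).eval θ) = ∏ h, thomEncoding p P θ h ^ (α.1 h : ℕ) := by
    have := map_prod (signHom (α := R)) (fun h : Fin (p - 1) =>
      ((derivative^[(h : ℕ) + 1] P) ^ (α.1 h : ℕ)).eval θ) Finset.univ
    rw [pder, eval_prod]
    refine this.trans (Finset.prod_congr rfl fun h _ => ?_)
    rw [eval_pow, map_pow]
    rfl
  rw [h1]
  exact map_prod (SignType.castHom (α := ℤ)) _ _ |>.trans (by simp)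

theorem thomEncoding_injOn {P : R[X]} (hP0 : P ≠ 0) (hP : P.natDegree = p) :
    Set.InjOn (thomEncoding p P) {θ | P.eval θ = 0} := by
  intro a ha b hb h
  refine eq_of_sign_derivative_eq hP0 ha hb fun k => ?_
  rcases k with _ | k
  · rw [Function.iterate_zero_apply, show P.eval a = 0 from ha, show P.eval b = 0 from hb]
  · rcases lt_or_ge k (p - 1) with hk | hk
    · exact congrFun h ⟨k, hk⟩
    -- Derivatives of order at least p are constant, so the Thom encoding need not record them.
    · have := natDegree_iterate_derivative P (k + 1)
      rw [eq_C_of_natDegree_le_zero (p := derivative^[k + 1] P) (by omega), eval_C, eval_C]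

/-- Grouping the roots by Thom encoding turns a Tarski query into a moment. -/
theorem moment_rootWeight {j : ℕ} (P A : R[X]) (α : Exponents p j) :
    moment α.1 (rootWeight p P fun θ => SignType.sign (A.eval θ)) =
      ∑ θ ∈ P.roots.toFinset, (SignType.sign ((pder P α * A).eval θ) : ℤ) := by
  simp only [moment, rootWeight, Finset.sum_mul]
  rw [← Finset.sum_fiberwise P.roots.toFinset (thomEncoding p P)]
  refine Finset.sum_congr rfl fun σ _ => Finset.sum_congr rfl fun θ hθ => ?_
  rw [Finset.mem_filter] at hθ
  rw [eval_mul, sign_mul, SignType.coe_mul, sign_eval_pder, hθ.2, mul_comm]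

theorem rootWeight_apply_thomEncoding {P : R[X]} (hP0 : P ≠ 0) (hP : P.natDegree = p) (u : R → ℤ)
    {θ : R} (hθ : P.eval θ = 0) : rootWeight p P u (thomEncoding p P θ) = u θ := by
  rw [rootWeight, Finset.sum_eq_single_of_mem θ (by simpa [hP0] using hθ)]
  intro θ' hθ' hne
  simp only [Finset.mem_filter, Multiset.mem_toFinset, mem_roots hP0, IsRoot.def] at hθ'
  exact absurd (thomEncoding_injOn hP0 hP hθ'.1 hθ hθ'.2) hne

end Roots

/-- The weights supported on at most `p` sign conditions whose moments are the Tarski queries given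
by the signs of `thelim(P)`. -/
def IsThomWeight {p : ℕ} (τ : ThelimIndex p → SignType) (c : ThomCode p → ℤ) : Prop :=
  (Finset.univ.filter fun σ => c σ ≠ 0).card ≤ p ∧
    ∀ α : Exponents p (bit p), moment α.1 c = query fun j => τ (α, j)

/-- The set of Thom encodings determined by the signs of `thelim(P)`. -/
def thomSet {p : ℕ} (τ : ThelimIndex p → SignType) : Set (ThomCode p) :=
  {σ | ∃ c, IsThomWeight τ c ∧ c σ ≠ 0}

/-- The weights supported on the Thom encodings whose moments are the Tarski queries given by the
signs of `thelim(P; Q)`. -/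
def IsSignWeight {p : ℕ} (τ : ThelimIndex p → SignType) (τ' : ThelimWithIndex p → SignType)
    (c : ThomCode p → ℤ) : Prop :=
  (∀ σ, c σ ≠ 0 → σ ∈ thomSet τ) ∧
    -- Position 0 stands for the exponent 1, that is for B = Q.
    ∀ α : Exponents p (bit p - 1), moment α.1 c = query fun j => τ' (α, 0, j)

open Classical in
/-- The sign at the root with given Thom encoding, determined by the signs of `thelim(P)` and
`thelim(P; Q)`. -/
def signAt {p : ℕ} (τ : ThelimIndex p → SignType) (τ' : ThelimWithIndex p → SignType)
    (σ : ThomCode p) : SignType :=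
  -- For signs coming from actual P and Q the solution exists and is unique, so the choice is
  -- harmless; 0 is a default for all other lists.
  if h : ∃ c, IsSignWeight τ τ' c then SignType.sign (h.choose σ) else 0

section Determination

variable {R : Type*} [Field R] [LinearOrder R] [IsStrictOrderedRing R] [IsRealClosed R] {p : ℕ}
  {P : R[X]}

theorem isThomWeight_rootWeight (hP0 : P ≠ 0) (hP : P.natDegree = p) :
    IsThomWeight (signs (thelim p P))
      (rootWeight p P fun θ => SignType.sign ((1 : R[X]).eval θ)) := by
  refine ⟨(Finset.card_le_card fun σ hσ => ?_).trans (card_thomCodes_le hP), fun α => ?_⟩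
  · exact mem_thomCodes_of_rootWeight_ne_zero (Finset.mem_filter.mp hσ).2
  · rw [moment_rootWeight, mul_one, ← query_sign_hmi hP0 hP]
    rfl

theorem IsThomWeight.eq_rootWeight (hP0 : P ≠ 0) (hP : P.natDegree = p) {c : ThomCode p → ℤ}
    (hc : IsThomWeight (signs (thelim p P)) c) :
    c = rootWeight p P fun θ => SignType.sign ((1 : R[X]).eval θ) := by
  have hr := isThomWeight_rootWeight hP0 hP
  refine eq_of_moment_eq (k := bit p) ((Finset.univ.filter fun σ => c σ ≠ 0) ∪
    Finset.univ.filter fun σ => rootWeight p P (fun θ => SignType.sign ((1 : R[X]).eval θ)) σ ≠ 0)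
    (fun σ hσ => by simp [hσ]) (fun σ hσ => ?_) ?_ fun α hα => ?_
  · exact Finset.mem_union_right _ (Finset.mem_filter.mpr ⟨Finset.mem_univ _, hσ⟩)
  -- Both supports have at most p elements, and 2p < 2 ^ (bit p + 1).
  · have h := Nat.lt_pow_succ_log_self one_lt_two p
    refine (Finset.card_union_le _ _).trans_lt ((Nat.add_le_add hc.1 hr.1).trans_lt ?_)
    rw [bit, pow_succ 2 (Nat.log 2 p + 1)]
    omega
  · exact (hc.2 ⟨α, hα⟩).trans (hr.2 ⟨α, hα⟩).symm

theorem thomSet_eq (hP0 : P ≠ 0) (hP : P.natDegree = p) :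
    thomSet (signs (thelim p P)) = thomEncoding p P '' {θ | P.eval θ = 0} := by
  ext σ
  constructor
  · rintro ⟨c, hc, hσ⟩
    rw [hc.eq_rootWeight hP0 hP] at hσ
    obtain ⟨θ, hθ, rfl⟩ := Finset.mem_image.mp (mem_thomCodes_of_rootWeight_ne_zero hσ)
    exact ⟨θ, by simpa [hP0] using hθ, rfl⟩
  · rintro ⟨θ, hθ, rfl⟩
    exact ⟨_, isThomWeight_rootWeight hP0 hP, by
      rw [rootWeight_apply_thomEncoding hP0 hP _ hθ]; simp⟩

theorem isSignWeight_rootWeight (hP0 : P ≠ 0) (hP : P.natDegree = p) (Q : R[X]) :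
    IsSignWeight (signs (thelim p P)) (signs (thelimWith p P Q))
      (rootWeight p P fun θ => SignType.sign (Q.eval θ)) := by
  refine ⟨fun σ hσ => ?_, fun α => ?_⟩
  · rw [thomSet_eq hP0 hP]
    obtain ⟨θ, hθ, rfl⟩ := Finset.mem_image.mp (mem_thomCodes_of_rootWeight_ne_zero hσ)
    exact ⟨θ, by simpa [hP0] using hθ, rfl⟩
  · rw [moment_rootWeight, ← query_sign_hmi hP0 hP]
    simp [signs, thelimWith]

/-- Both weights live on the same known set of at most p < 2 ^ bit p encodings, so `bit p - 1`
nonzero exponents suffice. -/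
theorem IsSignWeight.eq_rootWeight (hP0 : P ≠ 0) (hP : P.natDegree = p) {Q : R[X]}
    {c : ThomCode p → ℤ} (hc : IsSignWeight (signs (thelim p P)) (signs (thelimWith p P Q)) c) :
    c = rootWeight p P fun θ => SignType.sign (Q.eval θ) := by
  refine eq_of_moment_eq (k := bit p - 1) (thomCodes p P) (fun σ hσ => ?_)
    (fun σ => mem_thomCodes_of_rootWeight_ne_zero)
    ((card_thomCodes_le hP).trans_lt (Nat.lt_pow_succ_log_self one_lt_two p)) fun α hα => ?_
  · have := hc.1 σ hσ
    rw [thomSet_eq hP0 hP] at this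
    obtain ⟨θ, hθ, rfl⟩ := this
    exact Finset.mem_image_of_mem _ (by simpa [hP0] using hθ)
  · exact (hc.2 ⟨α, hα⟩).trans ((isSignWeight_rootWeight hP0 hP Q).2 ⟨α, hα⟩).symm

theorem signAt_thomEncoding (hP0 : P ≠ 0) (hP : P.natDegree = p) (Q : R[X]) {θ : R}
    (hθ : P.eval θ = 0) :
    signAt (signs (thelim p P)) (signs (thelimWith p P Q)) (thomEncoding p P θ) =
      SignType.sign (Q.eval θ) := by
  have h : ∃ c, IsSignWeight (signs (thelim p P)) (signs (thelimWith p P Q)) c :=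
    ⟨_, isSignWeight_rootWeight hP0 hP Q⟩
  rw [signAt, dif_pos h, h.choose_spec.eq_rootWeight hP0 hP,
    rootWeight_apply_thomEncoding hP0 hP _ hθ]
  cases SignType.sign (Q.eval θ) <;> rfl

end Determination

end SignDetermination
end

theorem mainTheorem4 (p : ℕ) (hp : 1 ≤ p) :
    ∃ (T : (SignDetermination.ThelimIndex p → SignType) →
          (SignDetermination.ThelimWithIndex p → SignType) → Set (SignDetermination.ThomCode p))
      (S : (SignDetermination.ThelimIndex p → SignType) →
          (SignDetermination.ThelimWithIndex p → SignType) →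
          SignDetermination.ThomCode p → SignType),
      ∀ (R : Type*) [Field R] [LinearOrder R] [IsStrictOrderedRing R] [IsRealClosed R]
        (P Q : R[X]), P.natDegree = p →
        Set.BijOn (SignDetermination.thomEncoding p P) {θ : R | P.eval θ = 0}
          (T (SignDetermination.signs (SignDetermination.thelim p P))
            (SignDetermination.signs (SignDetermination.thelimWith p P Q))) ∧
        ∀ θ : R, P.eval θ = 0 →
          SignType.sign (Q.eval θ) =
            S (SignDetermination.signs (SignDetermination.thelim p P))
              (SignDetermination.signs (SignDetermination.thelimWith p P Q))
              (SignDetermination.thomEncoding p P θ) := by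
  refine ⟨fun τ _ => SignDetermination.thomSet τ, SignDetermination.signAt,
    fun R _ _ _ _ P Q hP => ?_⟩
  have hP0 : P ≠ 0 := by
    rintro rfl
    rw [natDegree_zero] at hP
    omega
  refine ⟨?_, fun θ hθ => (SignDetermination.signAt_thomEncoding hP0 hP Q hθ).symm⟩
  simp only [SignDetermination.thomSet_eq hP0 hP]
  exact (SignDetermination.thomEncoding_injOn hP0 hP).bijOn_image
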